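/- **Theorem.** Let $0<q\le 1$, let $g:\mathbb R^n\to\mathbb R^n$ be continuous, let $A$ be a real $n\times n$ matrix and $x_0\in\mathbb R^n$. Put $s(x)=(\operatorname{sgn}x_1,\dots,\operatorname{sgn}x_n)$ and $S(x)=\operatorname{Sgn}(x_1)\times\dots\times\operatorname{Sgn}(x_n)$, where $\operatorname{Sgn}(t)=\{\operatorname{sgn} t\}$ for $t\ne0$ and $\operatorname{Sgn}(0)=[-1,1]$. The discontinuous fractional problem $$D^qx=g(x)+A\,s(x),\qquad x(0)=x_0, \tag{1}$$ can be numerically integrated, in the following sense. *Conventions.* $D^q x=\frac{d}{dt}I^{1-q}(x-x(0))$ is the Caputo derivative, where $I^{\alpha}u(t)=\frac1{\Gamma(\alpha)}\int_0^t(t-\tau)^{\alpha-1}u(\tau)\,d\tau$ for $\alpha>0$ and $I^0u=u$. For continuous $f$, a solution on $[0,T]$ of $D^qx=f(x)$, $x(0)=x_0$, is a continuous $x$ satisfying the equation at every $t\in[0,T]$ (one-sided derivatives at the end points); a solution on $[0,\infty)$ is one on every $[0,T]$. A solution on $[0,T]$ of an inclusion $D^qx\in F(x)$, $x(0)=x_0$,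 is a continuous $x$ for which $I^{1-q}(x-x_0)$ is absolutely continuous and the inclusion holds for almost every $t\in[0,T]$. The Filippov regularization of $f$ is $F(x)=\bigcap_{\rho>0}\bigcap_{\mu(N)=0}\overline{\operatorname{conv}}\,f(B(x,\rho)\setminus N)$, where $\mu$ is Lebesgue measure. A *Filippov solution* of (1) is a solution of the inclusion given by the Filippov regularization of $g+A\,s$. For $\varepsilon>0$, an *$\varepsilon$-approximate selection of $AS$* is a map $h:\mathbb R^n\to\mathbb R^n$ such that for each $x$ there are $y$ and $z\in AS(y)$ with $\|x-y\|\le\varepsilon$ and $\|h(x)-z\|\le\varepsilon$, and such that $h(x)$ lies in the convex hull of $\bigcup_yAS(y)$. A problem has *no blow-up until $T$* if its solutions on $[0,T']$, over all $0<T'\le T$, have a common bound. For a problem $D^qx=f(x)$, $x(0)=x_0$, the *Diethelm–Ford–Freed (DFF) scheme* with $N$ steps on $[0,T]$ is, with $\eta=T/N$ and $X_0=x_0$, $$P_{m+1}=x_0+\frac1{\Gamma(q)}\sum_{j=0}^m b_{j,m+1}f(X_j),\qquad X_{m+1}=x_0+\frac{\eta^q}{\Gamma(q+2)}\Big(f(P_{m+1})+\sum_{j=0}^m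 a_{j,m+1}f(X_j)\Big),$$ where $b_{j,m+1}=\frac{\eta^q}{q}\big((m+1-j)^q-(m-j)^q\big)$, $a_{0,m+1}=m^{q+1}-(m-q)(m+1)^q$, and $a_{j,m+1}=(m-j+2)^{q+1}+(m-j)^{q+1}-2(m-j+1)^{q+1}$ for $1\le j\le m$. It is *$\delta$-close* to a function $x$ if $\|X_k-x(kT/N)\|\le\delta$ for all $0\le k\le N$. *Claims.* 1. The Filippov regularization of $g+A\,s$ is $x\mapsto g(x)+AS(x)$. 2. For every $\varepsilon>0$ there is a locally Lipschitz $\varepsilon$-approximate selection $h$ of $AS$ that equals $A\,s$ at every point whose distance from the set of discontinuity points of $g+A\,s$ is at least $\varepsilon$ (at every point, if that set is empty). 3. There is $T>0$ such that neither the Filippov inclusion nor, for any $\varepsilon>0$ and any continuous $\varepsilon$-approximate selection $h$ of $AS$, the problem $$D^qx=g(x)+h(x),\qquad x(0)=x_0, \tag{2}$$ blows up until $T$. If $\|g(x)\|\le C(1+\|x\|)$ for some constant $C$ and all $x$, this is true for every $T>0$. 4. For every $\varepsilon>0$ and every continuous $\varepsilon$-approximate selection $h$ of $AS$: * if (2)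 has no blow-up until $T>0$, then (2) has a solution on $[0,T]$, and for every $\delta>0$ and all sufficiently large $N$ the DFF scheme for (2) is $\delta$-close to some solution of (2) on $[0,T]$; * if (2) has no blow-up until $T$ for any $T>0$, then (2) has a solution on $[0,\infty)$; * if $x$ is a solution of (2) on $[0,T]$, $T>0$, and every solution of (2) on any $[0,T']$ with $0<T'\le T$ agrees with $x$ there, then for every $\delta>0$ and all sufficiently large $N$ the DFF scheme for (2) on $[0,T]$ is $\delta$-close to $x$; * if $g$ and $h$ are locally Lipschitz, then for every $T>0$ any two solutions of (2) on $[0,T]$ coincide. 5. If the Filippov inclusion has no blow-up until $T>0$, then (1) has a Filippov solution on $[0,T]$, and for every $\delta>0$ there is $\varepsilon_0>0$ such that for all $0<\varepsilon<\varepsilon_0$ and every continuous $\varepsilon$-approximate selection $h$ of $AS$: (2) has no blow-up until $T$; every solution of (2) on $[0,T]$ is uniformly within $\delta$ of some Filippov solution of (1) on $[0,T]$; and for all sufficiently large $N$ the DFF scheme for (2) is $\delta$-close to some Filippov solution of (1) on $[0,T]$. -/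

import Mathlib

open Set Filter Topology MeasureTheory

noncomputable section

/-- Euclidean space of dimension `n`. -/
abbrev Euc (n : ℕ) : Type := EuclideanSpace ℝ (Fin n)

/-! ### The discontinuous right-hand side and its Filippov regularization -/

/-- The vector function `s(x) = (sgn x₁, …, sgn xₙ)`. -/
def sgnVec {n : ℕ} (x : Euc n) : Euc n := WithLp.toLp 2 fun i => Real.sign (x i)

/-- The discontinuous term `A s(x)`. -/
def switchTerm {n : ℕ} (A : Matrix (Fin n) (Fin n) ℝ) (x : Euc n) : Euc n :=
  Matrix.toEuclideanLin A (sgnVec x)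

/-- The set-valued sign function. -/
def Sgn (t : ℝ) : Set ℝ := if 0 < t then {1} else if t = 0 then Icc (-1) 1 else {-1}

/-- `S(x) = Sgn x₁ × ⋯ × Sgn xₙ`. -/
def SgnVec {n : ℕ} (x : Euc n) : Set (Euc n) := {y | ∀ i, y i ∈ Sgn (x i)}

/-- The set-valued map `A S`. -/
def SwitchTerm {n : ℕ} (A : Matrix (Fin n) (Fin n) ℝ) (x : Euc n) : Set (Euc n) :=
  Matrix.toEuclideanLin A '' SgnVec x

/-- The Filippov regularization of `f`: closed convex hulls of the values of `f` on small balls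
around `x`, up to Lebesgue null sets. -/
def filippov {n : ℕ} (f : Euc n → Euc n) (x : Euc n) : Set (Euc n) :=
  ⋂ (ε : ℝ) (_ : 0 < ε) (N : Set (Euc n)) (_ : volume N = 0),
    closure (convexHull ℝ (f '' (Metric.ball x ε \ N)))

/-- The set of discontinuity (switching) points of `f`. -/
def switchSet {n : ℕ} (f : Euc n → Euc n) : Set (Euc n) := {x | ¬ ContinuousAt f x}

/-- `h` is an `ε`-approximate selection of the set-valued map `F`: its graph lies in the
`ε`-neighbourhood of the graph of `F`, and its values lie in the convex hull of the image of
`F`. -/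
def IsApproxSelection {n : ℕ} (F : Euc n → Set (Euc n)) (ε : ℝ) (h : Euc n → Euc n) : Prop :=
  ∀ x, (∃ y, ∃ z ∈ F y, ‖x - y‖ ≤ ε ∧ ‖h x - z‖ ≤ ε) ∧ h x ∈ convexHull ℝ (⋃ y, F y)

/-! ### Fractional calculus -/

/-- Riemann–Liouville integral of order `α ≥ 0` with base point `0` (the identity if `α = 0`). -/
def rlIntegral {n : ℕ} (α : ℝ) (u : ℝ → Euc n) (t : ℝ) : Euc n :=
  if α = 0 then u t else (Real.Gamma α)⁻¹ • ∫ s in (0 : ℝ)..t, (t - s) ^ (α - 1) • u s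

/-- The function whose derivative is the Caputo derivative of order `q ∈ (0, 1]` of `x`:
`D^q x = d/dt I^{1-q} (x - x(0))`. -/
def caputoPrimitive {n : ℕ} (q : ℝ) (x : ℝ → Euc n) : ℝ → Euc n :=
  rlIntegral (1 - q) fun s => x s - x 0

/-- `x` is a solution on `[0, T]` of `D^q x = f(x)`, `x(0) = x₀` (one-sided derivatives at the
end points). -/
structure IsCaputoSol {n : ℕ} (q : ℝ) (f : Euc n → Euc n) (x₀ : Euc n) (T : ℝ)
    (x : ℝ → Euc n) : Prop where
  cont : ContinuousOn x (Icc 0 T)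
  init : x 0 = x₀
  eqn : ∀ t ∈ Icc 0 T, HasDerivWithinAt (caputoPrimitive q x) (f (x t)) (Icc 0 T) t

/-- `x` is a solution on `[0, T]` of the inclusion `D^q x ∈ F(x)` for a.a. `t`, `x(0) = x₀`. -/
structure IsInclusionSol {n : ℕ} (q : ℝ) (F : Euc n → Set (Euc n)) (x₀ : Euc n) (T : ℝ)
    (x : ℝ → Euc n) : Prop where
  cont : ContinuousOn x (Icc 0 T)
  init : x 0 = x₀
  ac : AbsolutelyContinuousOnInterval (caputoPrimitive q x) 0 T
  incl : ∀ᵐ t : ℝ, t ∈ Icc 0 T → ∃ v ∈ F (x t), HasDerivAt (caputoPrimitive q x) v t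

/-- No blow-up until time `T`: all solutions on `[0, T']`, over all `0 < T' ≤ T`, have a common
bound. Here `Sol T' x` says that `x` is a solution on `[0, T']`. -/
def NoBlowUp {n : ℕ} (Sol : ℝ → (ℝ → Euc n) → Prop) (T : ℝ) : Prop :=
  ∃ R : ℝ, ∀ T' ∈ Ioc 0 T, ∀ x, Sol T' x → ∀ t ∈ Icc 0 T', ‖x t‖ ≤ R

/-! ### The Diethelm–Ford–Freed predictor-corrector scheme -/

/-- Predictor weight `b_{j,m+1}` for step size `h`. -/
def dffB (q h : ℝ) (j m : ℕ) : ℝ :=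
  h ^ q / q * (((m : ℝ) + 1 - j) ^ q - ((m : ℝ) - j) ^ q)

/-- Corrector weight `a_{j,m+1}` for `0 ≤ j ≤ m` (and `a_{m+1,m+1} = 1`). -/
def dffA (q : ℝ) (j m : ℕ) : ℝ :=
  if j = 0 then (m : ℝ) ^ (q + 1) - ((m : ℝ) - q) * ((m : ℝ) + 1) ^ q
  else ((m : ℝ) - j + 2) ^ (q + 1) + ((m : ℝ) - j) ^ (q + 1) - 2 * ((m : ℝ) - j + 1) ^ (q + 1)

/-- The iterates of the scheme with step size `h` for `D^q x = f(x)`, `x(0) = x₀`: `dff q h f x₀ k`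
is the approximation of `x(k h)`. -/
def dff {n : ℕ} (q h : ℝ) (f : Euc n → Euc n) (x₀ : Euc n) : ℕ → Euc n
  | 0 => x₀
  | m + 1 =>
    let p : Euc n :=
      x₀ + (Real.Gamma q)⁻¹ • ∑ j : Fin (m + 1), dffB q h j m • f (dff q h f x₀ j)
    x₀ + (h ^ q / Real.Gamma (q + 2)) • f p
      + (h ^ q / Real.Gamma (q + 2)) • ∑ j : Fin (m + 1), dffA q j m • f (dff q h f x₀ j)
  termination_by k => k
  decreasing_by all_goals exact j.isLt

/-- On the uniform grid with `N` steps on `[0, T]`, the iterates of the scheme for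
`D^q x = f(x)`, `x(0) = x₀` stay within `δ` of the function `x`. -/
def DffWithin {n : ℕ} (q : ℝ) (f : Euc n → Euc n) (x₀ : Euc n) (T : ℝ) (N : ℕ) (δ : ℝ)
    (x : ℝ → Euc n) : Prop :=
  ∀ k ≤ N, ‖dff q (T / N) f x₀ k - x (k * (T / N))‖ ≤ δ

end

/-! For bounded v, the equation D^q x = v, x(0) = x₀ amounts to the Volterra equation x = x₀ + I^q v
(`IsVolterra`), and then I^{1-q}(x - x₀) is the ordinary integral of v. A bound on v has two
consequences. All such x share a Hölder modulus of exponent q, so they form a compact family;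
compactness is used through limits along ultrafilters (`ultraLim`). And the difference quotients of
I^{1-q}(x - x₀) are averages of v, so those of a limit lie in every closed convex set that
eventually contains the values of v (`ultraLim_slope_mem`). No convergence of v itself is needed.
Hence limits of approximate solutions are solutions, both for continuous right-hand sides and for
inclusions with closed convex values.

The scheme fits this frame: its predictor is exactly x₀ + I^q of a step function
(`dffPredictor_eq`), and the predictor and corrector weights differ by increments of a monotone
function, so that their differences telescope and the iterates are O(η^q) away
(`norm_dff_sub_predictor_le`). If closeness failed for arbitrarily large N, an ultrafilter limit
along the bad N would be a solution that some bad N approximates. Existence for (2) is a by-product.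
A bounded right-hand side is arranged by a cutoff that solutions never feel.

As ε tends to 0, solutions of (2) accumulate at Filippov solutions because A S is upper
semicontinuous with compact convex values (`ultraLim_isFilippovSol`). All values of selections lie
in the compact convex set A S(0), so a first-exit argument or a Gronwall inequality gives bounds
independent of ε and h. The regularization is g + A S because each sign vector adjacent to x is
taken by s on an open orthant, which has positive measure near x; selections arise by saturating the
sign function. -/

/-! ### Riemann–Liouville integrals of bounded functions -/

theorem rlIntegral_of_pos {n : ℕ} {a : ℝ} (ha : 0 < a) (u : ℝ → Euc n) (t : ℝ) :
    rlIntegral a u t = (Real.Gamma a)⁻¹ • ∫ s in (0 : ℝ)..t, (t - s) ^ (a - 1) • u s :=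
  if_neg ha.ne'

theorem rlIntegral_zero_order {n : ℕ} (u : ℝ → Euc n) (t : ℝ) : rlIntegral 0 u t = u t :=
  if_pos rfl

theorem rlIntegral_one {n : ℕ} (u : ℝ → Euc n) (t : ℝ) :
    rlIntegral 1 u t = ∫ s in (0 : ℝ)..t, u s := by
  simp [rlIntegral_of_pos one_pos]

theorem intervalIntegrable_kernel {a : ℝ} (ha : 0 < a) (t c d : ℝ) :
    IntervalIntegrable (fun s => (t - s) ^ (a - 1)) volume c d := by
  have h := (intervalIntegral.intervalIntegrable_rpow' (r := a - 1) (a := t - c) (b := t - d)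
    (by linarith)).comp_sub_left t
  simpa using h

theorem integral_kernel {a : ℝ} (ha : 0 < a) (t c d : ℝ) :
    ∫ s in c..d, (t - s) ^ (a - 1) = ((t - c) ^ a - (t - d) ^ a) / a := by
  rw [intervalIntegral.integral_comp_sub_left (fun x => x ^ (a - 1)) t,
    integral_rpow (Or.inl (by linarith))]
  simp

theorem IntervalIntegrable.smul_of_bounded {n : ℕ} {k : ℝ → ℝ} {c d : ℝ}
    (hk : IntervalIntegrable k volume c d) {v : ℝ → Euc n} (hv : Measurable v) {M : ℝ}
    (hM : ∀ s, ‖v s‖ ≤ M) : IntervalIntegrable (fun s => k s • v s) volume c d := by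
  rw [intervalIntegrable_iff] at hk ⊢
  refine Integrable.mono' (hk.norm.mul_const M)
    (hk.aestronglyMeasurable.smul hv.aestronglyMeasurable) (ae_of_all _ fun s => ?_)
  rw [norm_smul]
  exact mul_le_mul_of_nonneg_left (hM s) (norm_nonneg _)

theorem intervalIntegrable_of_bounded {n : ℕ} {v : ℝ → Euc n} (hv : Measurable v) {M : ℝ}
    (hM : ∀ s, ‖v s‖ ≤ M) (c d : ℝ) : IntervalIntegrable v volume c d := by
  have := IntervalIntegrable.smul_of_bounded (k := fun _ => 1) (c := c) (d := d)
    (by simp) hv hM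
  simpa using this

/-- A shifted and scaled Beta integral. Since a + b = 1, the length t - r enters with exponent 0 and
Γ(a + b) = 1, so the value depends on neither end point. -/
theorem integral_kernel_mul_kernel {a b : ℝ} (ha : 0 < a) (hb : 0 < b) (hab : a + b = 1)
    {r t : ℝ} (hrt : r < t) :
    ∫ s in r..t, (t - s) ^ (a - 1) * (s - r) ^ (b - 1) = Real.Gamma a * Real.Gamma b := by
  have h1 := Complex.betaIntegral_scaled (b : ℂ) (a : ℂ) (sub_pos.2 hrt)
  have h2 := Complex.betaIntegral_eq_Gamma_mul_div (b : ℂ) (a : ℂ) (by simpa) (by simpa)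
  have hba : (b : ℂ) + a = 1 := by rw [add_comm]; exact_mod_cast hab
  rw [h2, hba, Complex.Gamma_one, div_one, sub_self, Complex.cpow_zero, one_mul,
    Complex.Gamma_ofReal, Complex.Gamma_ofReal] at h1
  have h3 : ∫ x in (0:ℝ)..(t - r), (t - r - x) ^ (a - 1) * x ^ (b - 1)
      = Real.Gamma a * Real.Gamma b := by
    apply Complex.ofReal_injective
    rw [← intervalIntegral.integral_ofReal]
    rw [Complex.ofReal_mul, mul_comm (Real.Gamma a : ℂ), ← h1]
    refine intervalIntegral.integral_congr fun x hx => ?_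
    rw [uIcc_of_le (sub_pos.2 hrt).le] at hx
    rw [Complex.ofReal_mul, Complex.ofReal_cpow hx.1, Complex.ofReal_cpow (by linarith [hx.2])]
    push_cast
    ring
  rw [← h3]
  have := intervalIntegral.integral_comp_sub_right (a := r) (b := t)
    (fun x => (t - r - x) ^ (a - 1) * x ^ (b - 1)) r
  rw [sub_self] at this
  rw [← this]
  simp

/-- Fubini on the triangle r < s < t: integrating out s leaves the constant Beta value in front of v
r. -/
theorem rlIntegral_comp_aux {n : ℕ} {a b : ℝ} (ha : 0 < a) (hb : 0 < b) (hab : a + b = 1)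
    {v : ℝ → Euc n} (hv : Measurable v) {M : ℝ} (hM : ∀ s, ‖v s‖ ≤ M) {t : ℝ} (ht : 0 ≤ t) :
    rlIntegral a (rlIntegral b v) t = ∫ s in (0 : ℝ)..t, v s := by
  set μ : Measure ℝ := volume.restrict (Ioc 0 t) with hμ
  -- Extending the kernel by zero off the triangle lets both variables run over the same interval,
  -- so the swap takes place on a product measure.
  set k : ℝ → ℝ → ℝ := fun s r => if r < s then (t - s) ^ (a - 1) * (s - r) ^ (b - 1) else 0
    with hk
  have hkm : Measurable (Function.uncurry k) := by
    refine Measurable.ite (measurableSet_lt measurable_snd measurable_fst) ?_ measurable_const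
    fun_prop
  have hk0 : ∀ s ∈ Ioc 0 t, ∀ r, 0 ≤ k s r := by
    intro s hs r
    simp only [hk]
    split_ifs with h
    · exact mul_nonneg (Real.rpow_nonneg (by linarith [hs.2]) _)
        (Real.rpow_nonneg (by linarith) _)
    · exact le_rfl
  have hpos : 0 < Real.Gamma a * Real.Gamma b :=
    mul_pos (Real.Gamma_pos_of_pos ha) (Real.Gamma_pos_of_pos hb)
  have hks : ∀ r ∈ Ioo 0 t, (fun s => k s r) =ᵐ[μ]
      (Ioc r t).indicator (fun s => (t - s) ^ (a - 1) * (s - r) ^ (b - 1)) := by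
    intro r hr
    rw [hμ]
    filter_upwards [ae_restrict_mem measurableSet_Ioc] with s hs
    by_cases h : r < s
    · simp [hk, h, hs.2]
    · simp [hk, h]
  have hres : ∀ r ∈ Ioo 0 t, μ.restrict (Ioc r t) = volume.restrict (Ioc r t) := by
    intro r hr
    rw [hμ, Measure.restrict_restrict measurableSet_Ioc,
      inter_eq_left.2 (Ioc_subset_Ioc_left hr.1.le)]
  have hint : ∀ r ∈ Ioo 0 t, Integrable (fun s => k s r) μ ∧
      ∫ s, k s r ∂μ = Real.Gamma a * Real.Gamma b := by
    intro r hr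
    have h1 := integral_kernel_mul_kernel ha hb hab hr.2
    -- The integral of a non-integrable function is 0 by convention, so the nonzero Beta value
    -- already proves integrability.
    have h2 : IntervalIntegrable (fun s => (t - s) ^ (a - 1) * (s - r) ^ (b - 1)) volume r t :=
      intervalIntegral.intervalIntegrable_of_integral_ne_zero (by rw [h1]; exact hpos.ne')
    rw [intervalIntegrable_iff_integrableOn_Ioc_of_le hr.2.le] at h2
    rw [intervalIntegral.integral_of_le hr.2.le] at h1
    constructor
    · refine Integrable.congr ?_ (hks r hr).symm
      rw [integrable_indicator_iff measurableSet_Ioc, IntegrableOn, hres r hr]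
      exact h2
    · rw [integral_congr_ae (hks r hr), integral_indicator measurableSet_Ioc, hres r hr, h1]
  have hae : ∀ᵐ r ∂μ, r ∈ Ioo 0 t := by
    rw [hμ, ← restrict_Ioo_eq_restrict_Ioc]
    exact ae_restrict_mem measurableSet_Ioo
  have hF : Integrable (Function.uncurry fun s r => k s r • v r) (μ.prod μ) := by
    have hm : AEStronglyMeasurable (Function.uncurry fun s r => k s r • v r) (μ.prod μ) :=
      (hkm.smul (hv.comp measurable_snd)).aestronglyMeasurable
    rw [integrable_prod_iff' hm]
    constructor
    · filter_upwards [hae] with r hr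
      exact (hint r hr).1.smul_const (v r)
    · have : (fun r => ∫ s, ‖k s r • v r‖ ∂μ) =ᵐ[μ]
          fun r => Real.Gamma a * Real.Gamma b * ‖v r‖ := by
        filter_upwards [hae] with r hr
        rw [← (hint r hr).2, ← integral_mul_const]
        refine integral_congr_ae ?_
        rw [hμ]
        filter_upwards [ae_restrict_mem measurableSet_Ioc] with s hs
        rw [norm_smul, Real.norm_of_nonneg (hk0 s hs r)]
      refine Integrable.congr ?_ this.symm
      refine Integrable.const_mul ?_ _
      refine Integrable.mono' (integrable_const M) hv.aestronglyMeasurable.norm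
        (ae_of_all _ fun s => by simpa using hM s)
  have hswap := integral_integral_swap hF
  have hinner : ∀ s ∈ Ioc 0 t, ∫ r, k s r • v r ∂μ
      = (t - s) ^ (a - 1) • ∫ r in (0 : ℝ)..s, (s - r) ^ (b - 1) • v r := by
    intro s hs
    have e1 : (fun r => k s r • v r) = (Iio s).indicator
        (fun r => (t - s) ^ (a - 1) • ((s - r) ^ (b - 1) • v r)) := by
      ext1 r
      by_cases h : r < s
      · simp [hk, h, mul_smul]
      · simp [hk, h]
    have e2 : Iio s ∩ Ioc 0 t = Ioo 0 s := by
      ext r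
      simp only [mem_inter_iff, mem_Iio, mem_Ioc, mem_Ioo]
      exact ⟨fun h => ⟨h.2.1, h.1⟩, fun h => ⟨h.2, h.1, h.2.le.trans hs.2⟩⟩
    rw [e1, integral_indicator measurableSet_Iio, hμ, Measure.restrict_restrict measurableSet_Iio,
      e2, integral_smul, intervalIntegral.integral_of_le hs.1.le, integral_Ioc_eq_integral_Ioo]
  have h1 : ∫ s in (0 : ℝ)..t, (t - s) ^ (a - 1) • rlIntegral b v s
      = (Real.Gamma b)⁻¹ • ∫ s, ∫ r, k s r • v r ∂μ ∂μ := by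
    rw [intervalIntegral.integral_of_le ht, ← integral_smul]
    refine setIntegral_congr_fun measurableSet_Ioc fun s hs => ?_
    beta_reduce
    rw [rlIntegral_of_pos hb, smul_comm, hinner s hs]
  have h2 : ∫ r, ∫ s, k s r • v r ∂μ ∂μ = (Real.Gamma a * Real.Gamma b) • ∫ r, v r ∂μ := by
    rw [← integral_smul]
    refine integral_congr_ae ?_
    filter_upwards [hae] with r hr
    rw [integral_smul_const, (hint r hr).2]
  rw [rlIntegral_of_pos ha, h1, hswap, h2, intervalIntegral.integral_of_le ht, smul_smul, smul_smul,
    ← mul_inv, inv_mul_cancel₀ hpos.ne', one_smul]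

/-- The semigroup law for complementary orders. -/
theorem rlIntegral_rlIntegral {n : ℕ} {a b : ℝ} (ha : 0 ≤ a) (hb : 0 ≤ b) (hab : a + b = 1)
    {v : ℝ → Euc n} (hv : Measurable v) {M : ℝ} (hM : ∀ s, ‖v s‖ ≤ M) {t : ℝ} (ht : 0 ≤ t) :
    rlIntegral a (rlIntegral b v) t = ∫ s in (0 : ℝ)..t, v s := by
  rcases ha.eq_or_lt with rfl | ha
  · rw [zero_add] at hab
    rw [hab, rlIntegral_zero_order, rlIntegral_one]
  rcases hb.eq_or_lt with rfl | hb
  · rw [add_zero] at hab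
    rw [hab, rlIntegral_one]
    simp only [rlIntegral_zero_order]
  exact rlIntegral_comp_aux ha hb hab hv hM ht

theorem rlIntegral_congr {n : ℕ} {a : ℝ} {u u' : ℝ → Euc n} {t : ℝ} (ht : 0 ≤ t)
    (h : ∀ s ∈ Icc 0 t, u s = u' s) : rlIntegral a u t = rlIntegral a u' t := by
  unfold rlIntegral
  split_ifs with ha
  · exact h t ⟨ht, le_rfl⟩
  · congr 1
    refine intervalIntegral.integral_congr fun s hs => ?_
    rw [uIcc_of_le ht] at hs
    simp only [h s hs]

theorem rlIntegral_sub {n : ℕ} {a : ℝ} (ha : 0 ≤ a) {u u' : ℝ → Euc n} (hu : Measurable u)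
    (hu' : Measurable u') {M M' : ℝ} (hM : ∀ s, ‖u s‖ ≤ M) (hM' : ∀ s, ‖u' s‖ ≤ M') (t : ℝ) :
    rlIntegral a (fun s => u s - u' s) t = rlIntegral a u t - rlIntegral a u' t := by
  rcases ha.eq_or_lt with rfl | ha
  · simp [rlIntegral_zero_order]
  · rw [rlIntegral_of_pos ha, rlIntegral_of_pos ha, rlIntegral_of_pos ha, ← smul_sub,
      ← intervalIntegral.integral_sub ((intervalIntegrable_kernel ha t 0 t).smul_of_bounded hu hM)
        ((intervalIntegrable_kernel ha t 0 t).smul_of_bounded hu' hM')]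
    simp only [smul_sub]

theorem norm_rlIntegral_le_integral {n : ℕ} {a : ℝ} (ha : 0 < a) {u : ℝ → Euc n} {φ : ℝ → ℝ}
    {t : ℝ} (ht : 0 ≤ t) (h : ∀ᵐ s, s ∈ Ioc 0 t → ‖u s‖ ≤ φ s)
    (hφ : IntervalIntegrable (fun s => (t - s) ^ (a - 1) * φ s) volume 0 t) :
    ‖rlIntegral a u t‖ ≤ (Real.Gamma a)⁻¹ * ∫ s in (0 : ℝ)..t, (t - s) ^ (a - 1) * φ s := by
  have hG : 0 ≤ (Real.Gamma a)⁻¹ := (inv_pos.2 (Real.Gamma_pos_of_pos ha)).le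
  rw [rlIntegral_of_pos ha, norm_smul, Real.norm_of_nonneg hG]
  refine mul_le_mul_of_nonneg_left ?_ hG
  refine intervalIntegral.norm_integral_le_of_norm_le ht ?_ hφ
  filter_upwards [h] with s hs hst
  rw [norm_smul, Real.norm_of_nonneg (Real.rpow_nonneg (by linarith [hst.2]) _)]
  exact mul_le_mul_of_nonneg_left (hs hst) (Real.rpow_nonneg (by linarith [hst.2]) _)

theorem Gamma_inv_mul_div {a : ℝ} (ha : 0 < a) (c : ℝ) :
    (Real.Gamma a)⁻¹ * (c / a) = c / Real.Gamma (a + 1) := by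
  rw [Real.Gamma_add_one ha.ne']
  have := (Real.Gamma_pos_of_pos ha).ne'
  field_simp

theorem norm_rlIntegral_le {n : ℕ} {a : ℝ} (ha : 0 ≤ a) {u : ℝ → Euc n} {M : ℝ}
    {t : ℝ} (ht : 0 ≤ t) (h : ∀ s ∈ Icc 0 t, ‖u s‖ ≤ M) :
    ‖rlIntegral a u t‖ ≤ M * (t ^ a / Real.Gamma (a + 1)) := by
  rcases ha.eq_or_lt with rfl | ha
  · simpa [rlIntegral_zero_order] using h t ⟨ht, le_rfl⟩
  · refine (norm_rlIntegral_le_integral ha ht (φ := fun _ => M)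
      (ae_of_all _ fun s hs => h s (Ioc_subset_Icc_self hs))
      ((intervalIntegrable_kernel ha t 0 t).mul_const M)).trans_eq ?_
    rw [intervalIntegral.integral_mul_const, integral_kernel ha, sub_self, sub_zero,
      Real.zero_rpow ha.ne', sub_zero, ← mul_assoc, Gamma_inv_mul_div ha, mul_comm]

/-- Split at s. On [0, s] the kernel decreases in its end point because q ≤ 1, so the absolute
difference of the kernels integrates exactly; the sum is M (2 (t - s)^q - (t^q - s^q)) / q, and the
subtracted term is nonnegative. -/
theorem norm_rlIntegral_sub_le {n : ℕ} {q : ℝ} (hq0 : 0 < q) (hq1 : q ≤ 1) {v : ℝ → Euc n}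
    (hv : Measurable v) {M : ℝ} (hM : ∀ s, ‖v s‖ ≤ M) {s t : ℝ} (hs : 0 ≤ s) (hst : s ≤ t) :
    ‖rlIntegral q v t - rlIntegral q v s‖ ≤ 2 * M / Real.Gamma (q + 1) * (t - s) ^ q := by
  have hM0 : 0 ≤ M := (norm_nonneg _).trans (hM 0)
  have hi := fun t c d => (intervalIntegrable_kernel hq0 t c d).smul_of_bounded hv hM
  have hG : 0 ≤ (Real.Gamma q)⁻¹ := (inv_pos.2 (Real.Gamma_pos_of_pos hq0)).le
  rw [rlIntegral_of_pos hq0, rlIntegral_of_pos hq0, ← smul_sub,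
    ← intervalIntegral.integral_add_adjacent_intervals (hi t 0 s) (hi t s t), add_sub_right_comm,
    ← intervalIntegral.integral_sub (hi t 0 s) (hi s 0 s), norm_smul, Real.norm_of_nonneg hG]
  have h1 : ‖∫ r in (0 : ℝ)..s, ((t - r) ^ (q - 1) • v r - (s - r) ^ (q - 1) • v r)‖
      ≤ ∫ r in (0 : ℝ)..s, ((s - r) ^ (q - 1) - (t - r) ^ (q - 1)) * M := by
    refine intervalIntegral.norm_integral_le_of_norm_le hs ?_ (((intervalIntegrable_kernel hq0
      s 0 s).sub (intervalIntegrable_kernel hq0 t 0 s)).mul_const M)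
    -- The point r = s is removed: for q < 1 the convention 0 ^ (q - 1) = 0 breaks monotonicity of
    -- the kernel there.
    filter_upwards [compl_mem_ae_iff.2 (measure_singleton s)] with r hrs hr
    have hr' : r < s := lt_of_le_of_ne hr.2 hrs
    have : (t - r) ^ (q - 1) ≤ (s - r) ^ (q - 1) :=
      Real.rpow_le_rpow_of_nonpos (by linarith) (by linarith) (by linarith)
    rw [← sub_smul, norm_smul, Real.norm_of_nonpos (by linarith), neg_sub]
    exact mul_le_mul_of_nonneg_left (hM r) (by linarith)
  have h2 : ‖∫ r in s..t, (t - r) ^ (q - 1) • v r‖ ≤ ∫ r in s..t, (t - r) ^ (q - 1) * M := by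
    refine intervalIntegral.norm_integral_le_of_norm_le hst (ae_of_all _ fun r hr => ?_)
      ((intervalIntegrable_kernel hq0 t s t).mul_const M)
    rw [norm_smul, Real.norm_of_nonneg (Real.rpow_nonneg (by linarith [hr.2]) _)]
    exact mul_le_mul_of_nonneg_left (hM r) (Real.rpow_nonneg (by linarith [hr.2]) _)
  rw [intervalIntegral.integral_mul_const, intervalIntegral.integral_sub
    (intervalIntegrable_kernel hq0 s 0 s) (intervalIntegrable_kernel hq0 t 0 s),
    integral_kernel hq0, integral_kernel hq0] at h1
  rw [intervalIntegral.integral_mul_const, integral_kernel hq0] at h2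
  simp only [sub_self, sub_zero, Real.zero_rpow hq0.ne'] at h1 h2
  have h3 : s ^ q ≤ t ^ q := Real.rpow_le_rpow hs hst hq0.le
  have h4 : ‖(∫ r in (0 : ℝ)..s, ((t - r) ^ (q - 1) • v r - (s - r) ^ (q - 1) • v r))
      + ∫ r in s..t, (t - r) ^ (q - 1) • v r‖ ≤ (2 * M * (t - s) ^ q) / q := by
    refine (norm_add_le _ _).trans ((add_le_add h1 h2).trans ?_)
    rw [← sub_nonneg]
    have : 2 * M * (t - s) ^ q / q - ((s ^ q / q - (t ^ q - (t - s) ^ q) / q) * M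
        + (t - s) ^ q / q * M) = (t ^ q - s ^ q) * M / q := by ring
    rw [this]
    exact div_nonneg (mul_nonneg (by linarith) hM0) hq0.le
  refine (mul_le_mul_of_nonneg_left h4 hG).trans_eq ?_
  rw [Gamma_inv_mul_div hq0]
  ring

/-! ### Equivalence with Volterra equations -/

/-- `x = x₀ + I^q v` on `[0, T]`, with `v` measurable and bounded by `M`. -/
structure IsVolterra {n : ℕ} (q : ℝ) (x₀ : Euc n) (T M : ℝ) (v x : ℝ → Euc n) : Prop where
  meas : Measurable v
  bound : ∀ s, ‖v s‖ ≤ M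
  eqn : ∀ t ∈ Icc 0 T, x t = x₀ + rlIntegral q v t

theorem rlIntegral_at_zero {n : ℕ} {q : ℝ} (hq0 : 0 < q) (v : ℝ → Euc n) :
    rlIntegral q v 0 = 0 := by
  rw [rlIntegral_of_pos hq0, intervalIntegral.integral_same, smul_zero]

theorem caputoPrimitive_zero {n : ℕ} (q : ℝ) (x : ℝ → Euc n) : caputoPrimitive q x 0 = 0 := by
  unfold caputoPrimitive rlIntegral
  split_ifs <;> simp

theorem IsVolterra.init {n : ℕ} {q : ℝ} {x₀ : Euc n} {T M : ℝ} {v x : ℝ → Euc n}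
    (h : IsVolterra q x₀ T M v x) (hq0 : 0 < q) (hT : 0 ≤ T) : x 0 = x₀ := by
  rw [h.eqn 0 ⟨le_rfl, hT⟩, rlIntegral_at_zero hq0, add_zero]

theorem IsVolterra.nonneg {n : ℕ} {q : ℝ} {x₀ : Euc n} {T M : ℝ} {v x : ℝ → Euc n}
    (h : IsVolterra q x₀ T M v x) : 0 ≤ M := (norm_nonneg _).trans (h.bound 0)

/-- The Hölder modulus common to all solutions of Volterra equations with bounded right-hand
side. -/
theorem IsVolterra.norm_sub_le {n : ℕ} {q : ℝ} {x₀ : Euc n} {T M : ℝ} {v x : ℝ → Euc n}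
    (h : IsVolterra q x₀ T M v x) (hq0 : 0 < q) (hq1 : q ≤ 1) {s t : ℝ} (hs : s ∈ Icc 0 T)
    (ht : t ∈ Icc 0 T) : ‖x t - x s‖ ≤ 2 * M / Real.Gamma (q + 1) * |t - s| ^ q := by
  wlog hst : s ≤ t generalizing s t
  · rw [norm_sub_rev, abs_sub_comm]
    exact this ht hs (le_of_not_ge hst)
  rw [h.eqn t ht, h.eqn s hs, add_sub_add_left_eq_sub, abs_of_nonneg (sub_nonneg.2 hst)]
  exact norm_rlIntegral_sub_le hq0 hq1 h.meas h.bound hs.1 hst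

theorem holder_continuousOn {n : ℕ} {q C : ℝ} (hq0 : 0 < q) {x : ℝ → Euc n} {S : Set ℝ}
    (h : ∀ s ∈ S, ∀ t ∈ S, ‖x t - x s‖ ≤ C * |t - s| ^ q) : ContinuousOn x S := by
  intro s hs
  rw [ContinuousWithinAt, tendsto_iff_norm_sub_tendsto_zero]
  have h1 : Tendsto (fun t => C * |t - s| ^ q) (𝓝[S] s) (𝓝 (C * |s - s| ^ q)) := by
    refine Tendsto.mono_left (Continuous.tendsto ?_ s) nhdsWithin_le_nhds
    exact continuous_const.mul ((continuous_id.sub continuous_const).abs.rpow_const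
      fun _ => Or.inr hq0.le)
  rw [sub_self, abs_zero, Real.zero_rpow hq0.ne', mul_zero] at h1
  exact squeeze_zero' (Eventually.of_forall fun t => norm_nonneg _)
    (eventually_mem_nhdsWithin.mono fun t ht => h s hs t ht) h1

theorem IsVolterra.continuousOn {n : ℕ} {q : ℝ} {x₀ : Euc n} {T M : ℝ} {v x : ℝ → Euc n}
    (h : IsVolterra q x₀ T M v x) (hq0 : 0 < q) (hq1 : q ≤ 1) : ContinuousOn x (Icc 0 T) :=
  holder_continuousOn hq0 fun _ hs _ ht => h.norm_sub_le hq0 hq1 hs ht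

theorem IsVolterra.caputoPrimitive_eq {n : ℕ} {q : ℝ} {x₀ : Euc n} {T M : ℝ} {v x : ℝ → Euc n}
    (h : IsVolterra q x₀ T M v x) (hq0 : 0 < q) (hq1 : q ≤ 1) {t : ℝ} (ht : t ∈ Icc 0 T) :
    caputoPrimitive q x t = ∫ s in (0 : ℝ)..t, v s := by
  rw [← rlIntegral_rlIntegral (a := 1 - q) (b := q) (by linarith) hq0.le (by ring) h.meas h.bound
    ht.1, caputoPrimitive, h.init hq0 (ht.1.trans ht.2)]
  refine rlIntegral_congr ht.1 fun s hs => ?_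
  rw [h.eqn s ⟨hs.1, hs.2.trans ht.2⟩, add_sub_cancel_left]

/-- Solutions are controlled on [0, T] only, whereas the semigroup law asks for global measurability
and a global bound; constant continuation supplies both. -/
theorem exists_measurable_extension {n : ℕ} {T : ℝ} (hT : 0 ≤ T) {x : ℝ → Euc n}
    (hx : ContinuousOn x (Icc 0 T)) {M : ℝ} (hM : ∀ t ∈ Icc 0 T, ‖x t‖ ≤ M) :
    ∃ X : ℝ → Euc n, Continuous X ∧ (∀ s, ‖X s‖ ≤ M) ∧ ∀ t ∈ Icc 0 T, X t = x t := by
  refine ⟨IccExtend hT ((Icc 0 T).domRestrict x), ?_, fun s => ?_, fun t ht => ?_⟩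
  · exact (continuousOn_iff_continuous_domRestrict.1 hx).Icc_extend'
  · exact hM _ (projIcc 0 T hT s).2
  · rw [IccExtend_of_mem hT _ ht]; rfl

theorem exists_norm_bound {n : ℕ} {T : ℝ} {x : ℝ → Euc n}
    (hx : ContinuousOn x (Icc 0 T)) : ∃ M, 0 ≤ M ∧ ∀ t ∈ Icc 0 T, ‖x t‖ ≤ M := by
  obtain ⟨M, hM⟩ := isCompact_Icc.exists_bound_of_continuousOn hx
  exact ⟨max M 0, le_max_right _ _, fun t ht => (hM t ht).trans (le_max_left _ _)⟩

theorem eqOn_zero_of_integral_eq_zero {n : ℕ} {T : ℝ} (hT : 0 < T) {u : ℝ → Euc n}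
    (hu : Continuous u) (h : ∀ t ∈ Icc 0 T, ∫ s in (0 : ℝ)..t, u s = 0) :
    ∀ t ∈ Icc 0 T, u t = 0 := by
  intro t ht
  have h1 : HasDerivWithinAt (fun t => ∫ s in (0 : ℝ)..t, u s) (u t) (Icc 0 T) t :=
    (intervalIntegral.integral_hasDerivAt_right (hu.intervalIntegrable _ _)
      (hu.stronglyMeasurableAtFilter _ _) hu.continuousAt).hasDerivWithinAt
  have h2 : HasDerivWithinAt (fun t => ∫ s in (0 : ℝ)..t, u s) 0 (Icc 0 T) t :=
    (hasDerivWithinAt_const t (Icc 0 T) (0 : Euc n)).congr h (h t ht)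
  exact (uniqueDiffOn_Icc hT t ht).eq_deriv _ h1 h2

/-- Abel's inversion: the Caputo primitive determines the function. -/
theorem isVolterra_of_caputoPrimitive {n : ℕ} {q : ℝ} (hq0 : 0 < q) (hq1 : q ≤ 1) {x₀ : Euc n}
    {T M : ℝ} (hT : 0 < T) {v x : ℝ → Euc n} (hx : ContinuousOn x (Icc 0 T)) (hx0 : x 0 = x₀)
    (hv : Measurable v) (hM : ∀ s, ‖v s‖ ≤ M)
    (h : ∀ t ∈ Icc 0 T, caputoPrimitive q x t = ∫ s in (0 : ℝ)..t, v s) :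
    IsVolterra q x₀ T M v x := by
  refine ⟨hv, hM, fun t ht => ?_⟩
  have hz : IsVolterra q x₀ T M v fun t => x₀ + rlIntegral q v t := ⟨hv, hM, fun _ _ => rfl⟩
  have hxc : ContinuousOn (fun s => x s - x 0) (Icc 0 T) := hx.sub continuousOn_const
  have hyc : ContinuousOn (rlIntegral q v) (Icc 0 T) :=
    ((hz.continuousOn hq0 hq1).sub (continuousOn_const (c := x₀))).congr fun s _ => by simp
  obtain ⟨K, -, hK⟩ := exists_norm_bound hxc
  obtain ⟨L, -, hL⟩ := exists_norm_bound hyc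
  obtain ⟨X, hXc, hXK, hX⟩ := exists_measurable_extension hT.le hxc hK
  obtain ⟨Y, hYc, hYL, hY⟩ := exists_measurable_extension hT.le hyc hL
  have hXY : Continuous fun s => X s - Y s := hXc.sub hYc
  -- `X` and `Y` have the same integral of order 1 - q. Applying I^q to the difference turns this
  -- into the vanishing of an ordinary integral, which can be differentiated.
  have h0 : ∀ t ∈ Icc 0 T, ∫ s in (0 : ℝ)..t, (X s - Y s) = 0 := by
    intro t ht
    rw [← rlIntegral_rlIntegral (a := q) (b := 1 - q) hq0.le (by linarith) (by ring)
      hXY.measurable (M := K + L)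
      (fun s => (norm_sub_le _ _).trans (add_le_add (hXK s) (hYL s))) ht.1]
    have h1 : ∀ s ∈ Icc 0 t, rlIntegral (1 - q) (fun s => X s - Y s) s = (fun _ => 0) s := by
      intro s hs
      have hsT : s ≤ T := hs.2.trans ht.2
      rw [rlIntegral_sub (by linarith) hXc.measurable hYc.measurable hXK hYL,
        rlIntegral_congr hs.1 (fun r hr => hX r ⟨hr.1, hr.2.trans hsT⟩),
        rlIntegral_congr hs.1 (fun r hr => hY r ⟨hr.1, hr.2.trans hsT⟩),
        rlIntegral_rlIntegral (by linarith) hq0.le (by ring) hv hM hs.1, ← h s ⟨hs.1, hsT⟩]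
      exact sub_self _
    rw [rlIntegral_congr ht.1 h1, rlIntegral_of_pos hq0]
    simp
  have h1 := eqOn_zero_of_integral_eq_zero hT hXY h0 t ht
  rw [hX t ht, hY t ht, sub_eq_zero, hx0] at h1
  rw [← h1]
  abel

theorem IsCaputoSol.exists_isVolterra {n : ℕ} {q : ℝ} (hq0 : 0 < q) (hq1 : q ≤ 1)
    {f : Euc n → Euc n} (hf : Continuous f) {x₀ : Euc n} {T M : ℝ} (hT : 0 < T) {x : ℝ → Euc n}
    (hx : IsCaputoSol q f x₀ T x) (hM : ∀ t ∈ Icc 0 T, ‖f (x t)‖ ≤ M) :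
    ∃ v, IsVolterra q x₀ T M v x ∧ ∀ t ∈ Icc 0 T, v t = f (x t) := by
  obtain ⟨v, hvc, hvM, hv⟩ := exists_measurable_extension hT.le (hf.comp_continuousOn hx.cont) hM
  refine ⟨v, isVolterra_of_caputoPrimitive hq0 hq1 hT hx.cont hx.init hvc.measurable hvM ?_, hv⟩
  intro t ht
  have hsub : Icc 0 t ⊆ Icc 0 T := Icc_subset_Icc_right ht.2
  have hd : ∀ s ∈ Ioo 0 t, HasDerivAt (caputoPrimitive q x) (v s) s := fun s hs => by
    have := hx.eqn s (hsub (Ioo_subset_Icc_self hs))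
    rw [hv s (hsub (Ioo_subset_Icc_self hs))]
    exact this.hasDerivAt (Icc_mem_nhds hs.1 (hs.2.trans_le ht.2))
  have hc : ContinuousOn (caputoPrimitive q x) (Icc 0 t) := fun s hs =>
    ((hx.eqn s (hsub hs)).continuousWithinAt).mono hsub
  rw [intervalIntegral.integral_eq_sub_of_hasDerivAt_of_le ht.1 hc hd
    (hvc.intervalIntegrable _ _), caputoPrimitive_zero, sub_zero]

theorem integral_lipschitz {n : ℕ} {v : ℝ → Euc n} (hv : Measurable v) {M : ℝ}
    (hM : ∀ s, ‖v s‖ ≤ M) : LipschitzWith M.toNNReal fun t => ∫ s in (0 : ℝ)..t, v s := by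
  have hM0 : 0 ≤ M := (norm_nonneg _).trans (hM 0)
  refine LipschitzWith.of_dist_le_mul fun a b => ?_
  rw [dist_eq_norm, intervalIntegral.integral_interval_sub_left
    (intervalIntegrable_of_bounded hv hM _ _) (intervalIntegrable_of_bounded hv hM _ _),
    Real.coe_toNNReal M hM0, Real.dist_eq]
  exact intervalIntegral.norm_integral_le_of_norm_le_const fun s _ => hM s

theorem IsInclusionSol.exists_isVolterra {n : ℕ} {q : ℝ} (hq0 : 0 < q) (hq1 : q ≤ 1)
    {F : Euc n → Set (Euc n)} {x₀ : Euc n} {T M : ℝ} (hT : 0 < T) (hM0 : 0 ≤ M) {x : ℝ → Euc n}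
    (hx : IsInclusionSol q F x₀ T x) (hM : ∀ t ∈ Icc 0 T, ∀ z ∈ F (x t), ‖z‖ ≤ M) :
    ∃ v, IsVolterra q x₀ T M v x ∧ ∀ᵐ t : ℝ, t ∈ Icc 0 T → v t ∈ F (x t) := by
  set w := caputoPrimitive q x with hw
  -- Cutting off large derivatives makes `v` bounded everywhere; almost everywhere on [0, T] the
  -- derivative lies in F (x t), so nothing is lost.
  set v : ℝ → Euc n := {s | ‖deriv w s‖ ≤ M}.indicator (deriv w) with hv
  have hvm : Measurable v := (measurable_deriv w).indicator
    (measurableSet_le (measurable_deriv w).norm measurable_const)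
  have hvM : ∀ s, ‖v s‖ ≤ M := fun s => by
    by_cases h : s ∈ {s | ‖deriv w s‖ ≤ M}
    · rw [hv, indicator_of_mem h]; exact h
    · rw [hv, indicator_of_notMem h, norm_zero]; exact hM0
  have hae : ∀ᵐ t : ℝ, t ∈ Icc 0 T → v t ∈ F (x t) ∧ HasDerivAt w (v t) t := by
    filter_upwards [hx.incl] with t ht htT
    obtain ⟨z, hz, hd⟩ := ht htT
    have h1 : v t = z := by
      rw [hv, indicator_of_mem, hd.deriv]
      show ‖deriv w t‖ ≤ M
      rw [hd.deriv]
      exact hM t htT z hz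
    rw [h1]
    exact ⟨hz, hd⟩
  refine ⟨v, isVolterra_of_caputoPrimitive hq0 hq1 hT hx.cont hx.init hvm hvM ?_,
    hae.mono fun t ht htT => (ht htT).1⟩
  have hac : AbsolutelyContinuousOnInterval (fun t => ∫ s in (0 : ℝ)..t, v s) 0 T :=
    (integral_lipschitz hvm hvM).lipschitzOnWith.absolutelyContinuousOnInterval
  -- Absolute continuity enters here: the primitive and the integral of `v` have the same derivative
  -- almost everywhere, hence differ by a constant, which is 0 at time 0.
  obtain ⟨C, hC⟩ := (hx.ac.sub hac).const_of_ae_hasDerivAt_zero (by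
    filter_upwards [hae, (intervalIntegrable_of_bounded hvm hvM 0 T).ae_hasDerivAt_integral]
      with t h1 h2 ht
    have ht' := ht
    rw [uIcc_of_le hT.le] at ht'
    have := (h1 ht').2.sub (h2 ht 0 left_mem_uIcc)
    rwa [sub_self] at this)
  rw [uIcc_of_le hT.le] at hC
  have h0 := hC 0 ⟨le_rfl, hT.le⟩
  simp only [Pi.sub_apply, intervalIntegral.integral_same, caputoPrimitive_zero, sub_self] at h0
  intro t ht
  have := hC t ht
  rw [← h0] at this
  exact sub_eq_zero.1 this

/-! ### Gronwall inequality for the singular kernel -/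

theorem integral_kernel_mul_exp_le {q lam : ℝ} (hq0 : 0 < q) (hl : 0 < lam) {t : ℝ}
    (ht : 0 ≤ t) :
    ∫ s in (0 : ℝ)..t, (t - s) ^ (q - 1) * Real.exp (lam * s)
      ≤ Real.exp (lam * t) * ((1 / lam) ^ q * Real.Gamma q) := by
  have h1 := Real.integral_rpow_mul_exp_neg_mul_Ioi hq0 hl
  have hint : IntegrableOn (fun s : ℝ => s ^ (q - 1) * Real.exp (-(lam * s))) (Ioi 0) := by
    refine not_imp_comm.1 integral_undef ?_
    rw [h1]
    exact (mul_pos (Real.rpow_pos_of_pos (by positivity) _) (Real.Gamma_pos_of_pos hq0)).ne'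
  have h2 : ∫ s in (0 : ℝ)..t, (t - s) ^ (q - 1) * Real.exp (lam * s)
      = Real.exp (lam * t) * ∫ s in (0 : ℝ)..t, s ^ (q - 1) * Real.exp (-(lam * s)) := by
    have h3 := intervalIntegral.integral_comp_sub_left (a := 0) (b := t)
      (fun s => s ^ (q - 1) * Real.exp (-(lam * s))) t
    rw [sub_self, sub_zero] at h3
    rw [← h3, ← intervalIntegral.integral_const_mul]
    refine intervalIntegral.integral_congr fun s _ => ?_
    rw [mul_left_comm, ← Real.exp_add]
    congr 2
    ring
  rw [h2, ← h1]
  refine mul_le_mul_of_nonneg_left ?_ (Real.exp_pos _).le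
  rw [intervalIntegral.integral_of_le ht]
  refine setIntegral_mono_set hint ?_ Ioc_subset_Ioi_self.eventuallyLE
  filter_upwards [ae_restrict_mem measurableSet_Ioi] with s hs
  exact mul_nonneg (Real.rpow_nonneg (le_of_lt hs) _) (Real.exp_pos _).le

/-- A Gronwall inequality for weakly singular kernels. -/
theorem exists_gronwall {q b : ℝ} (hq0 : 0 < q) (hb : 0 ≤ b) :
    ∃ lam > 0, ∀ (a T : ℝ) (φ : ℝ → ℝ), 0 ≤ a → ContinuousOn φ (Icc 0 T) →
      (∀ t ∈ Icc 0 T, φ t ≤ a + b * ∫ s in (0 : ℝ)..t, (t - s) ^ (q - 1) * φ s) →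
      ∀ t ∈ Icc 0 T, φ t ≤ 2 * a * Real.exp (lam * t) := by
  have hΓ := Real.Gamma_pos_of_pos hq0
  have hpos : 0 < 2 * b * Real.Gamma q + 1 := by positivity
  -- With lam ^ q = 2 b Γ(q) + 1, the operator φ ↦ b ∫ (t - s)^(q-1) φ(s) ds has norm at most 1/2 in
  -- the supremum weighted by exp(-lam t). The weighted maximum S then obeys S ≤ a + S / 2.
  set lam : ℝ := (2 * b * Real.Gamma q + 1) ^ (1 / q) with hlam
  have hl : 0 < lam := Real.rpow_pos_of_pos hpos _
  refine ⟨lam, hl, fun a T φ ha hφ h t ht => ?_⟩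
  have hlq : (1 / lam) ^ q = 1 / (2 * b * Real.Gamma q + 1) := by
    rw [Real.div_rpow zero_le_one hl.le, Real.one_rpow, hlam, ← Real.rpow_mul hpos.le,
      one_div_mul_cancel hq0.ne', Real.rpow_one]
  have hψ : ContinuousOn (fun s => φ s * Real.exp (-(lam * s))) (Icc 0 T) :=
    hφ.mul (by fun_prop)
  obtain ⟨m, hm, hmax⟩ := isCompact_Icc.exists_isMaxOn ⟨t, ht⟩ hψ
  set S := φ m * Real.exp (-(lam * m)) with hS
  have hφS : ∀ s ∈ Icc 0 T, φ s ≤ S * Real.exp (lam * s) := fun s hs => by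
    have := mul_le_mul_of_nonneg_right (hmax hs) (Real.exp_pos (lam * s)).le
    simp only [mul_assoc, ← Real.exp_add] at this
    simpa [hS, mul_assoc, ← Real.exp_add] using this
  suffices S ≤ 2 * a from
    (hφS t ht).trans (mul_le_mul_of_nonneg_right this (Real.exp_pos _).le)
  -- Besides the contradiction, 2 a < S yields S ≥ 0, needed to multiply the kernel estimate by S.
  by_contra! hcon
  have hS0 : 0 ≤ S := by linarith
  have h1 : ∫ s in (0 : ℝ)..m, (m - s) ^ (q - 1) * φ s
      ≤ ∫ s in (0 : ℝ)..m, S * ((m - s) ^ (q - 1) * Real.exp (lam * s)) := by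
    refine intervalIntegral.integral_mono_on hm.1 ?_ ?_ fun s hs => ?_
    · refine (intervalIntegrable_kernel hq0 m 0 m).mul_continuousOn (hφ.mono ?_)
      rw [uIcc_of_le hm.1]
      exact Icc_subset_Icc_right hm.2
    · exact ((intervalIntegrable_kernel hq0 m 0 m).mul_continuousOn (by fun_prop)).const_mul S
    · rw [mul_left_comm]
      exact mul_le_mul_of_nonneg_left (hφS s ⟨hs.1, hs.2.trans hm.2⟩)
        (Real.rpow_nonneg (by linarith [hs.2]) _)
  rw [intervalIntegral.integral_const_mul] at h1
  have h2 := h1.trans (mul_le_mul_of_nonneg_left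
    (integral_kernel_mul_exp_le hq0 hl hm.1) hS0)
  have h3 := (h m hm).trans (add_le_add_right (mul_le_mul_of_nonneg_left h2 hb) a)
  have h4 := mul_le_mul_of_nonneg_right h3 (Real.exp_pos (-(lam * m))).le
  rw [← hS, hlq] at h4
  have h5 : Real.exp (lam * m) * Real.exp (-(lam * m)) = 1 := by
    rw [← Real.exp_add, add_neg_cancel, Real.exp_zero]
  have h6 : a * Real.exp (-(lam * m)) ≤ a :=
    mul_le_of_le_one_right ha (Real.exp_le_one_iff.2 (by nlinarith [hm.1]))
  have h7 : b * (1 / (2 * b * Real.Gamma q + 1) * Real.Gamma q) ≤ 1 / 2 := by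
    rw [one_div_mul_eq_div, mul_div_assoc', div_le_div_iff₀ hpos two_pos]
    linarith
  have h8 : (a + b * (S * (Real.exp (lam * m) * (1 / (2 * b * Real.Gamma q + 1) * Real.Gamma q))))
      * Real.exp (-(lam * m)) = a * Real.exp (-(lam * m))
        + S * (b * (1 / (2 * b * Real.Gamma q + 1) * Real.Gamma q))
          * (Real.exp (lam * m) * Real.exp (-(lam * m))) := by ring
  rw [h8, h5, mul_one] at h4
  nlinarith

/-! ### Ultrafilter limits of Volterra solutions -/

theorem norm_caputoPrimitive_sub_le {n : ℕ} {q : ℝ} (hq1 : q ≤ 1) {T ρ : ℝ}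
    {x y : ℝ → Euc n} (hx : ContinuousOn x (Icc 0 T)) (hy : ContinuousOn y (Icc 0 T))
    (h : ∀ s ∈ Icc 0 T, ‖x s - y s‖ ≤ ρ) {t : ℝ} (ht : t ∈ Icc 0 T) :
    ‖caputoPrimitive q x t - caputoPrimitive q y t‖
      ≤ 2 * ρ * (t ^ (1 - q) / Real.Gamma (1 - q + 1)) := by
  have hT : 0 ≤ T := ht.1.trans ht.2
  have hxc : ContinuousOn (fun s => x s - x 0) (Icc 0 T) := hx.sub continuousOn_const
  have hyc : ContinuousOn (fun s => y s - y 0) (Icc 0 T) := hy.sub continuousOn_const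
  obtain ⟨K, -, hK⟩ := exists_norm_bound hxc
  obtain ⟨L, -, hL⟩ := exists_norm_bound hyc
  obtain ⟨X, hXc, hXK, hX⟩ := exists_measurable_extension hT hxc hK
  obtain ⟨Y, hYc, hYL, hY⟩ := exists_measurable_extension hT hyc hL
  unfold caputoPrimitive
  rw [← rlIntegral_congr ht.1 (fun r hr => hX r ⟨hr.1, hr.2.trans ht.2⟩),
    ← rlIntegral_congr ht.1 (fun r hr => hY r ⟨hr.1, hr.2.trans ht.2⟩),
    ← rlIntegral_sub (by linarith) hXc.measurable hYc.measurable hXK hYL]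
  refine norm_rlIntegral_le (by linarith) ht.1 fun s hs => ?_
  have hsT : s ∈ Icc 0 T := ⟨hs.1, hs.2.trans ht.2⟩
  rw [hX s hsT, hY s hsT, sub_sub_sub_comm]
  refine (norm_sub_le _ _).trans ?_
  linarith [h s hsT, h 0 ⟨le_rfl, hT⟩]

/-- The pointwise limit of a family of functions along an ultrafilter. -/
noncomputable def ultraLim {ι : Type*} {n : ℕ} (U : Ultrafilter ι) (x : ι → ℝ → Euc n) (t : ℝ) :
    Euc n :=
  limUnder (U : Filter ι) fun k => x k t

section Compactness

variable {ι : Type*} {n : ℕ} {U : Ultrafilter ι} {q : ℝ} {x₀ : Euc n} {T M : ℝ}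
  {v x : ι → ℝ → Euc n}

/-- The Hölder bound from time 0 confines the values at t to a closed ball, where compactness makes
every ultrafilter converge. -/
theorem tendsto_ultraLim (hq0 : 0 < q) (hq1 : q ≤ 1)
    (hV : ∀ᶠ k in (U : Filter ι), IsVolterra q x₀ T M (v k) (x k)) {t : ℝ} (ht : t ∈ Icc 0 T) :
    Tendsto (fun k => x k t) U (𝓝 (ultraLim U x t)) := by
  refine tendsto_nhds_limUnder ?_
  have hb : ∀ᶠ k in (U : Filter ι),
      x k t ∈ Metric.closedBall x₀ (2 * M / Real.Gamma (q + 1) * |t - 0| ^ q) := by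
    filter_upwards [hV] with k hk
    have h0 : (0 : ℝ) ∈ Icc 0 T := ⟨le_rfl, ht.1.trans ht.2⟩
    rw [mem_closedBall_iff_norm, ← hk.init hq0 h0.2]
    exact hk.norm_sub_le hq0 hq1 h0 ht
  obtain ⟨y, -, hy⟩ := (isCompact_closedBall x₀
    (2 * M / Real.Gamma (q + 1) * |t - 0| ^ q)).ultrafilter_le_nhds
    (U.map fun k => x k t) (le_principal_iff.2 hb)
  exact ⟨y, hy⟩

theorem ultraLim_holder (hq0 : 0 < q) (hq1 : q ≤ 1)
    (hV : ∀ᶠ k in (U : Filter ι), IsVolterra q x₀ T M (v k) (x k)) {s t : ℝ} (hs : s ∈ Icc 0 T)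
    (ht : t ∈ Icc 0 T) :
    ‖ultraLim U x t - ultraLim U x s‖ ≤ 2 * M / Real.Gamma (q + 1) * |t - s| ^ q :=
  le_of_tendsto ((tendsto_ultraLim hq0 hq1 hV ht).sub (tendsto_ultraLim hq0 hq1 hV hs)).norm
    (hV.mono fun _ hk => hk.norm_sub_le hq0 hq1 hs ht)

theorem ultraLim_continuousOn (hq0 : 0 < q) (hq1 : q ≤ 1)
    (hV : ∀ᶠ k in (U : Filter ι), IsVolterra q x₀ T M (v k) (x k)) :
    ContinuousOn (ultraLim U x) (Icc 0 T) :=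
  holder_continuousOn hq0 fun _ hs _ ht => ultraLim_holder hq0 hq1 hV hs ht

theorem ultraLim_zero (hq0 : 0 < q) (hq1 : q ≤ 1)
    (hV : ∀ᶠ k in (U : Filter ι), IsVolterra q x₀ T M (v k) (x k)) (hT : 0 ≤ T) :
    ultraLim U x 0 = x₀ :=
  tendsto_nhds_unique (tendsto_ultraLim hq0 hq1 hV ⟨le_rfl, hT⟩)
    (tendsto_const_nhds.congr' (hV.mono fun _ hk => (hk.init hq0 hT).symm))

theorem exists_holder_modulus (hq0 : 0 < q) (C : ℝ) {ρ : ℝ} (hρ : 0 < ρ) :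
    ∃ θ > 0, ∀ r : ℝ, |r| < θ → C * |r| ^ q ≤ ρ := by
  have h1 : Tendsto (fun r : ℝ => C * |r| ^ q) (𝓝 0) (𝓝 (C * |(0 : ℝ)| ^ q)) :=
    Continuous.tendsto (continuous_const.mul (continuous_abs.rpow_const
      fun _ => Or.inr hq0.le)) 0
  rw [abs_zero, Real.zero_rpow hq0.ne', mul_zero] at h1
  obtain ⟨θ, hθ, h⟩ := Metric.eventually_nhds_iff.1 (h1.eventually_le_const hρ)
  exact ⟨θ, hθ, fun r hr => h (by simpa using hr)⟩

/-- The Arzelà–Ascoli argument: pointwise convergence on a finite net, carried to all of [0, T] by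
the common Hölder modulus. -/
theorem ultraLim_uniform (hq0 : 0 < q) (hq1 : q ≤ 1)
    (hV : ∀ᶠ k in (U : Filter ι), IsVolterra q x₀ T M (v k) (x k)) {ρ : ℝ} (hρ : 0 < ρ) :
    ∀ᶠ k in (U : Filter ι), ∀ t ∈ Icc 0 T, ‖x k t - ultraLim U x t‖ ≤ ρ := by
  obtain ⟨θ, hθ, hm⟩ := exists_holder_modulus hq0 (2 * M / Real.Gamma (q + 1))
    (ρ := ρ / 3) (by positivity)
  obtain ⟨S, hS, hSf, hcov⟩ := isCompact_Icc.finite_cover_balls (s := Icc 0 T) hθ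
  have h1 : ∀ᶠ k in (U : Filter ι), ∀ s ∈ S, ‖x k s - ultraLim U x s‖ < ρ / 3 := by
    refine (eventually_all_finite hSf).2 fun s hs => ?_
    have := tendsto_ultraLim hq0 hq1 hV (hS hs)
    exact (tendsto_iff_norm_sub_tendsto_zero.1 this).eventually_lt_const (by positivity)
  filter_upwards [h1, hV] with k hk hkV t ht
  obtain ⟨s, hs, hts⟩ := mem_iUnion₂.1 (hcov ht)
  rw [Metric.mem_ball, Real.dist_eq] at hts
  have e1 := (hkV.norm_sub_le hq0 hq1 (hS hs) ht).trans (hm _ hts)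
  have e2 := (ultraLim_holder hq0 hq1 hV (hS hs) ht).trans (hm _ hts)
  have e3 := hk s hs
  have e4 : x k t - ultraLim U x t = (x k t - x k s) + (x k s - ultraLim U x s)
      - (ultraLim U x t - ultraLim U x s) := by abel
  rw [e4]
  refine (norm_sub_le _ _).trans ?_
  linarith [norm_add_le (x k t - x k s) (x k s - ultraLim U x s)]

/-- The integrals of `v k` are the Caputo primitives of `x k`, and these depend continuously on `x
k` in the uniform norm. This replaces weak convergence of `v k`. -/
theorem tendsto_integral_ultraLim (hq0 : 0 < q) (hq1 : q ≤ 1)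
    (hV : ∀ᶠ k in (U : Filter ι), IsVolterra q x₀ T M (v k) (x k)) {t : ℝ} (ht : t ∈ Icc 0 T) :
    Tendsto (fun k => ∫ s in (0 : ℝ)..t, v k s) U (𝓝 (caputoPrimitive q (ultraLim U x) t)) := by
  set B := t ^ (1 - q) / Real.Gamma (1 - q + 1) with hB
  have hB0 : 0 ≤ B := div_nonneg (Real.rpow_nonneg ht.1 _)
    (Real.Gamma_pos_of_pos (by linarith)).le
  rw [Metric.tendsto_nhds]
  intro ε hε
  filter_upwards [hV, ultraLim_uniform hq0 hq1 hV (ρ := ε / (2 * B + 1) / 2) (by positivity)]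
    with k hk hu
  rw [dist_eq_norm, ← hk.caputoPrimitive_eq hq0 hq1 ht]
  refine (norm_caputoPrimitive_sub_le hq1 (hk.continuousOn hq0 hq1)
    (ultraLim_continuousOn hq0 hq1 hV) hu ht).trans_lt ?_
  rw [← hB]
  have : 2 * (ε / (2 * B + 1) / 2) * B = ε * (B / (2 * B + 1)) := by ring
  rw [this]
  refine mul_lt_of_lt_one_right hε ?_
  rw [div_lt_one (by positivity)]
  linarith

/-- Difference quotients of the limiting primitive lie in every closed convex set which eventually
contains the right-hand sides. -/
theorem ultraLim_slope_mem (hq0 : 0 < q) (hq1 : q ≤ 1)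
    (hV : ∀ᶠ k in (U : Filter ι), IsVolterra q x₀ T M (v k) (x k)) {a b : ℝ} (ha : a ∈ Icc 0 T)
    (hb : b ∈ Icc 0 T) (hab : a < b) {K : Set (Euc n)} (hK : Convex ℝ K) (hKc : IsClosed K)
    (h : ∀ᶠ k in (U : Filter ι), ∀ s ∈ Ioc a b, v k s ∈ K) :
    (b - a)⁻¹ • (caputoPrimitive q (ultraLim U x) b - caputoPrimitive q (ultraLim U x) a) ∈ K := by
  refine hKc.mem_of_tendsto (((tendsto_integral_ultraLim hq0 hq1 hV hb).sub
    (tendsto_integral_ultraLim hq0 hq1 hV ha)).const_smul (b - a)⁻¹) ?_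
  filter_upwards [h, hV] with k hk hkV
  have hi := intervalIntegrable_of_bounded hkV.meas hkV.bound
  rw [intervalIntegral.integral_interval_sub_left (hi _ _) (hi _ _), ← interval_average_eq,
    uIoc_of_le hab.le]
  refine hK.set_average_mem hKc ?_ ?_ ?_ ?_
  · simpa using hab
  · simp
  · filter_upwards [ae_restrict_mem measurableSet_Ioc] with s hs using hk s hs
  · exact (intervalIntegrable_iff_integrableOn_Ioc_of_le hab.le).1 (hi a b)

theorem ultraLim_primitive_sub (hq0 : 0 < q) (hq1 : q ≤ 1)
    (hV : ∀ᶠ k in (U : Filter ι), IsVolterra q x₀ T M (v k) (x k)) {a b : ℝ} (ha : a ∈ Icc 0 T)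
    (hb : b ∈ Icc 0 T) {c : Euc n} {ρ : ℝ}
    (h : ∀ᶠ k in (U : Filter ι), ∀ s ∈ uIcc a b, ‖v k s - c‖ ≤ ρ) :
    ‖caputoPrimitive q (ultraLim U x) b - caputoPrimitive q (ultraLim U x) a - (b - a) • c‖
      ≤ ρ * |b - a| := by
  wlog hab : a ≤ b generalizing a b
  · have := this hb ha (by rwa [uIcc_comm]) (le_of_not_ge hab)
    have e : ∀ A B : Euc n, A - B - (b - a) • c = -(B - A - (a - b) • c) := fun A B => by
      rw [← neg_sub b a, neg_smul]
      abel
    rwa [e, norm_neg, abs_sub_comm]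
  rcases hab.eq_or_lt with rfl | hab
  · simp
  have h1 := ultraLim_slope_mem hq0 hq1 hV ha hb hab (convex_closedBall c ρ)
    Metric.isClosed_closedBall (h.mono fun k hk s hs => by
      rw [mem_closedBall_iff_norm]
      exact hk s (by rw [uIcc_of_le hab.le]; exact Ioc_subset_Icc_self hs))
  rw [mem_closedBall_iff_norm] at h1
  have hpos : 0 < b - a := sub_pos.2 hab
  rw [abs_of_pos hpos]
  have h2 := mul_le_mul_of_nonneg_right h1 hpos.le
  have e : ∀ w : Euc n, w - (b - a) • c = (b - a) • ((b - a)⁻¹ • w - c) := fun w => by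
    rw [smul_sub, smul_inv_smul₀ hpos.ne']
  rwa [e, norm_smul, Real.norm_of_nonneg hpos.le, mul_comm]

theorem ultraLim_primitive_lipschitz (hq0 : 0 < q) (hq1 : q ≤ 1)
    (hV : ∀ᶠ k in (U : Filter ι), IsVolterra q x₀ T M (v k) (x k)) :
    LipschitzOnWith M.toNNReal (caputoPrimitive q (ultraLim U x)) (Icc 0 T) := by
  obtain ⟨k, hk⟩ := hV.exists
  refine LipschitzOnWith.of_dist_le_mul fun b hb a ha => ?_
  have := ultraLim_primitive_sub hq0 hq1 hV ha hb (c := 0) (ρ := M)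
    (hV.mono fun k hk s _ => by rw [sub_zero]; exact hk.bound s)
  rwa [smul_zero, sub_zero, ← Real.dist_eq, ← dist_eq_norm, ← Real.coe_toNNReal M hk.nonneg] at this

theorem ultraLim_hasDerivWithinAt (hq0 : 0 < q) (hq1 : q ≤ 1)
    (hV : ∀ᶠ k in (U : Filter ι), IsVolterra q x₀ T M (v k) (x k)) {t : ℝ} (ht : t ∈ Icc 0 T)
    {c : Euc n}
    (h : ∀ ρ > 0, ∃ θ > 0, ∀ᶠ k in (U : Filter ι), ∀ s ∈ Icc 0 T, |s - t| < θ → ‖v k s - c‖ ≤ ρ) :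
    HasDerivWithinAt (caputoPrimitive q (ultraLim U x)) c (Icc 0 T) t := by
  rw [hasDerivWithinAt_iff_isLittleO, Asymptotics.isLittleO_iff]
  intro ρ hρ
  obtain ⟨θ, hθ, hk⟩ := h ρ hρ
  filter_upwards [inter_mem_nhdsWithin (Icc 0 T) (Metric.ball_mem_nhds t hθ)] with s hs
  rw [Real.norm_eq_abs]
  refine ultraLim_primitive_sub hq0 hq1 hV ht hs.1 (hk.mono fun k hk r hr => hk r ?_ ?_)
  · exact ordConnected_Icc.uIcc_subset ht hs.1 hr
  · exact (abs_sub_left_of_mem_uIcc hr).trans_lt (by simpa [Real.dist_eq] using hs.2)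

/-- The derivative is a limit of right difference quotients, which lie in the closed ρ-thickening of
D near t; these thickenings intersect in D. A point to the right of t is all that is required, hence
t < T. -/
theorem ultraLim_deriv_mem (hq0 : 0 < q) (hq1 : q ≤ 1)
    (hV : ∀ᶠ k in (U : Filter ι), IsVolterra q x₀ T M (v k) (x k)) {t : ℝ} (ht : t ∈ Ico 0 T)
    {D : Set (Euc n)} (hD : Convex ℝ D) (hDc : IsClosed D)
    (h : ∀ ρ > 0, ∃ θ > 0, ∀ᶠ k in (U : Filter ι), ∀ s ∈ Icc 0 T, |s - t| < θ →
      v k s ∈ Metric.cthickening ρ D)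
    {d : Euc n} (hd : HasDerivAt (caputoPrimitive q (ultraLim U x)) d t) : d ∈ D := by
  rw [← hDc.closure_eq, Metric.closure_eq_iInter_cthickening]
  refine mem_iInter₂.2 fun ρ hρ => ?_
  obtain ⟨θ, hθ, hk⟩ := h ρ hρ
  have h1 := (hasDerivAt_iff_tendsto_slope.1 hd).mono_left
    (nhdsWithin_mono t (fun s (hs : s ∈ Ioi t) => ne_of_gt hs))
  refine Metric.isClosed_cthickening.mem_of_tendsto h1 ?_
  filter_upwards [Ioo_mem_nhdsGT (lt_min ht.2 (lt_add_of_pos_right t hθ))] with b hb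
  rw [slope_def_module]
  have hb2 := lt_min_iff.1 hb.2
  refine ultraLim_slope_mem hq0 hq1 hV ⟨ht.1, ht.2.le⟩ ⟨ht.1.trans hb.1.le, hb2.1.le⟩ hb.1
    (hD.cthickening ρ) Metric.isClosed_cthickening (hk.mono fun k hk s hs => hk s ?_ ?_)
  · exact ⟨ht.1.trans hs.1.le, hs.2.trans hb2.1.le⟩
  · rw [abs_of_pos (sub_pos.2 hs.1)]
    linarith [hs.2, hb2.2]

/-- Limits of approximate solutions are solutions: continuous right-hand sides. -/
theorem ultraLim_isCaputoSol (hq0 : 0 < q) (hq1 : q ≤ 1)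
    (hV : ∀ᶠ k in (U : Filter ι), IsVolterra q x₀ T M (v k) (x k)) (hT : 0 ≤ T)
    {f : Euc n → Euc n} (hf : Continuous f) (z : ι → ℝ → Euc n)
    (hz : ∀ᶠ k in (U : Filter ι), ∀ s ∈ Icc 0 T, v k s = f (z k s))
    (hzx : ∀ ρ > 0, ∀ᶠ k in (U : Filter ι), ∀ s ∈ Icc 0 T, ‖z k s - x k s‖ ≤ ρ) :
    IsCaputoSol q f x₀ T (ultraLim U x) := by
  refine ⟨ultraLim_continuousOn hq0 hq1 hV, ultraLim_zero hq0 hq1 hV hT, fun t ht => ?_⟩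
  refine ultraLim_hasDerivWithinAt hq0 hq1 hV ht fun ρ hρ => ?_
  -- The evaluation points `z k s` may differ from `x k s`, as they do for the scheme. Three errors
  -- of η/4 (`z` to `x`, `x` to its limit, s to t) stay below η.
  obtain ⟨η, hη, hfη⟩ := Metric.continuousAt_iff.1 (hf.continuousAt (x := ultraLim U x t)) ρ hρ
  obtain ⟨θ, hθ, hm⟩ := exists_holder_modulus hq0 (2 * M / Real.Gamma (q + 1))
    (ρ := η / 4) (by positivity)
  refine ⟨θ, hθ, ?_⟩
  filter_upwards [hz, hzx (η / 4) (by positivity),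
    ultraLim_uniform hq0 hq1 hV (ρ := η / 4) (by positivity)] with k h1 h2 h3 s hs hst
  rw [h1 s hs, ← dist_eq_norm]
  refine (hfη ?_).le
  rw [dist_eq_norm]
  have e4 : z k s - ultraLim U x t = (z k s - x k s) + (x k s - ultraLim U x s)
      + (ultraLim U x s - ultraLim U x t) := by abel
  rw [e4]
  have := (ultraLim_holder hq0 hq1 hV ht hs).trans (hm _ hst)
  linarith [h2 s hs, h3 s hs, norm_add₃_le (a := z k s - x k s) (b := x k s - ultraLim U x s)
    (c := ultraLim U x s - ultraLim U x t)]

/-- Limits of approximate solutions are solutions: differential inclusions. -/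
theorem ultraLim_isInclusionSol (hq0 : 0 < q) (hq1 : q ≤ 1)
    (hV : ∀ᶠ k in (U : Filter ι), IsVolterra q x₀ T M (v k) (x k)) {τ : ℝ} (hτ : τ ∈ Icc 0 T)
    {F : Euc n → Set (Euc n)} (hF : ∀ y, Convex ℝ (F y)) (hFc : ∀ y, IsClosed (F y))
    (h : ∀ t ∈ Ioo 0 τ, ∀ ρ > 0, ∃ θ > 0, ∀ᶠ k in (U : Filter ι), ∀ s ∈ Icc 0 T, |s - t| < θ →
      v k s ∈ Metric.cthickening ρ (F (ultraLim U x t))) :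
    IsInclusionSol q F x₀ τ (ultraLim U x) := by
  have hsub : Icc 0 τ ⊆ Icc 0 T := Icc_subset_Icc_right hτ.2
  have hlip := (ultraLim_primitive_lipschitz hq0 hq1 hV).mono hsub
  refine ⟨(ultraLim_continuousOn hq0 hq1 hV).mono hsub,
    ultraLim_zero hq0 hq1 hV (hτ.1.trans hτ.2), ?_, ?_⟩
  · exact LipschitzOnWith.absolutelyContinuousOnInterval (by rwa [uIcc_of_le hτ.1])
  · filter_upwards [hlip.ae_differentiableWithinAt_of_mem (μ := volume),
      compl_mem_ae_iff.2 (measure_singleton (0 : ℝ)), compl_mem_ae_iff.2 (measure_singleton τ)]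
      with t h1 h2 h3 ht
    have ht' : t ∈ Ioo 0 τ := ⟨lt_of_le_of_ne ht.1 (Ne.symm h2), lt_of_le_of_ne ht.2 h3⟩
    have hd := ((h1 ht).differentiableAt (Icc_mem_nhds ht'.1 ht'.2)).hasDerivAt
    exact ⟨_, ultraLim_deriv_mem hq0 hq1 hV ⟨ht.1, ht'.2.trans_le hτ.2⟩ (hF _) (hFc _) (h t ht') hd,
      hd⟩

end Compactness

/-! ### The set-valued sign and the Filippov regularization -/

theorem Sgn_subset (t : ℝ) : Sgn t ⊆ Icc (-1) 1 := by
  unfold Sgn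
  split_ifs <;> simp

theorem Sgn_zero : Sgn 0 = Icc (-1) 1 := by simp [Sgn]

theorem sign_mem_Sgn (t : ℝ) : Real.sign t ∈ Sgn t := by
  rcases lt_trichotomy t 0 with h | h | h
  · simp [Sgn, Real.sign_of_neg h, h.not_gt, h.ne]
  · simp [h, Sgn_zero]
  · simp [Sgn, Real.sign_of_pos h, h]

theorem convex_Sgn (t : ℝ) : Convex ℝ (Sgn t) := by
  unfold Sgn
  split_ifs
  exacts [convex_singleton _, convex_Icc _ _, convex_singleton _]

theorem isCompact_Sgn (t : ℝ) : IsCompact (Sgn t) := by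
  unfold Sgn
  split_ifs
  exacts [isCompact_singleton, isCompact_Icc, isCompact_singleton]

/-- Upper semicontinuity: the sign is locally constant away from 0, and at 0 the value contains all
others. -/
theorem eventually_Sgn_subset (t : ℝ) : ∀ᶠ s in 𝓝 t, Sgn s ⊆ Sgn t := by
  rcases lt_trichotomy t 0 with h | h | h
  · filter_upwards [Iio_mem_nhds h] with s hs
    have hs' : s < 0 := hs
    simp [Sgn, h.not_gt, h.ne, hs'.not_gt, hs'.ne]
  · rw [h, Sgn_zero]
    exact Eventually.of_forall Sgn_subset
  · filter_upwards [Ioi_mem_nhds h] with s hs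
    have hs' : 0 < s := hs
    simp [Sgn, h, hs']

section SetValued

variable {n : ℕ} (A : Matrix (Fin n) (Fin n) ℝ)

theorem continuous_toEuclideanLin : Continuous (Matrix.toEuclideanLin A) :=
  LinearMap.continuous_of_finiteDimensional _

theorem SgnVec_eq_image (x : Euc n) :
    SgnVec x = (WithLp.linearEquiv 2 ℝ (Fin n → ℝ)).symm.toLinearMap ''
      (univ.pi fun i => Sgn (x i)) := by
  ext y
  constructor
  · exact fun h => ⟨WithLp.ofLp y, fun i _ => h i, rfl⟩
  · rintro ⟨z, hz, rfl⟩ i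
    exact hz i (mem_univ i)

theorem isCompact_SgnVec (x : Euc n) : IsCompact (SgnVec x) := by
  rw [SgnVec_eq_image]
  exact (isCompact_univ_pi fun i => isCompact_Sgn _).image
    (LinearMap.continuous_of_finiteDimensional _)

theorem convex_SgnVec (x : Euc n) : Convex ℝ (SgnVec x) := by
  rw [SgnVec_eq_image]
  exact (convex_pi fun i _ => convex_Sgn _).linear_image _

theorem sgnVec_mem (x : Euc n) : sgnVec x ∈ SgnVec x := fun i => sign_mem_Sgn (x i)

theorem SgnVec_subset_zero (x : Euc n) : SgnVec x ⊆ SgnVec 0 := fun y hy i => by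
  rw [PiLp.zero_apply, Sgn_zero]
  exact Sgn_subset _ (hy i)

theorem eventually_SgnVec_subset (x : Euc n) : ∀ᶠ y in 𝓝 x, SgnVec y ⊆ SgnVec x := by
  have h : ∀ᶠ y : Euc n in 𝓝 x, ∀ i, Sgn (y i) ⊆ Sgn (x i) := eventually_all.2 fun i =>
    ((PiLp.continuous_apply 2 (fun _ => ℝ) i).tendsto x).eventually (eventually_Sgn_subset (x i))
  filter_upwards [h] with y hy z hz i using hy i (hz i)

theorem isCompact_SwitchTerm (x : Euc n) : IsCompact (SwitchTerm A x) :=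
  (isCompact_SgnVec x).image (continuous_toEuclideanLin A)

theorem convex_SwitchTerm (x : Euc n) : Convex ℝ (SwitchTerm A x) :=
  (convex_SgnVec x).linear_image _

theorem switchTerm_mem (x : Euc n) : switchTerm A x ∈ SwitchTerm A x :=
  mem_image_of_mem _ (sgnVec_mem x)

theorem SwitchTerm_subset_zero (x : Euc n) : SwitchTerm A x ⊆ SwitchTerm A 0 :=
  image_mono (SgnVec_subset_zero x)

theorem eventually_SwitchTerm_subset (x : Euc n) :
    ∀ᶠ y in 𝓝 x, SwitchTerm A y ⊆ SwitchTerm A x :=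
  (eventually_SgnVec_subset x).mono fun _ h => image_mono h

theorem exists_SwitchTerm_bound : ∃ L, 0 ≤ L ∧ ∀ x, ∀ z ∈ SwitchTerm A x, ‖z‖ ≤ L := by
  obtain ⟨L, hL⟩ := (isCompact_SwitchTerm A 0).isBounded.exists_norm_le
  exact ⟨max L 0, le_max_right _ _, fun x z hz =>
    (hL z (SwitchTerm_subset_zero A x hz)).trans (le_max_left _ _)⟩

/-- A S(0) is convex and contains every A S(y), hence their convex hull. This bounds all selections
uniformly in ε. -/
theorem IsApproxSelection.mem_zero {A : Matrix (Fin n) (Fin n) ℝ} {ε : ℝ} {h : Euc n → Euc n}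
    (hh : IsApproxSelection (SwitchTerm A) ε h) (x : Euc n) : h x ∈ SwitchTerm A 0 :=
  convexHull_min (iUnion_subset (SwitchTerm_subset_zero A)) (convex_SwitchTerm A 0) (hh x).2

theorem isCompact_translate (c x : Euc n) : IsCompact ((fun z => c + z) '' SwitchTerm A x) :=
  (isCompact_SwitchTerm A x).image (continuous_const.add continuous_id)

theorem convex_translate (c x : Euc n) : Convex ℝ ((fun z => c + z) '' SwitchTerm A x) :=
  (convex_SwitchTerm A x).translate c

/-- On a small ball the values lie in a thickening of the closed convex set g x + A S(x), by upper
semicontinuity. The null set N = ∅ suffices for this direction. -/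
theorem filippov_subset {g : Euc n → Euc n} (hg : Continuous g) (x : Euc n) :
    filippov (fun y => g y + switchTerm A y) x ⊆ (fun z => g x + z) '' SwitchTerm A x := by
  intro w hw
  rw [← (isCompact_translate A (g x) x).isClosed.closure_eq,
    Metric.closure_eq_iInter_cthickening]
  refine mem_iInter₂.2 fun ρ hρ => ?_
  have h1 : ∀ᶠ y in 𝓝 x, dist (g y) (g x) < ρ :=
    (hg.tendsto x).eventually (Metric.ball_mem_nhds _ hρ)
  obtain ⟨ε, hε, h2⟩ := Metric.eventually_nhds_iff_ball.1
    (h1.and (eventually_SwitchTerm_subset A x))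
  have h3 := mem_iInter₂.1 (mem_iInter₂.1 hw ε hε) ∅ measure_empty
  refine closure_minimal (convexHull_min ?_ ((convex_translate A (g x) x).cthickening ρ))
    Metric.isClosed_cthickening h3
  rintro _ ⟨y, hy, rfl⟩
  have h4 := h2 y hy.1
  refine Metric.mem_cthickening_of_dist_le _ (g x + switchTerm A y) _ _
    (mem_image_of_mem _ (h4.2 (switchTerm_mem A y))) ?_
  rw [dist_add_right]
  exact h4.1.le

/-- The sign vectors of the orthants whose closure contains `x`. -/
def signVertices (x : Euc n) : Set (Euc n) :=
  {σ | ∀ i, (σ i = 1 ∨ σ i = -1) ∧ 0 ≤ σ i * x i}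

theorem Sgn_subset_convexHull (t : ℝ) :
    Sgn t ⊆ convexHull ℝ {s : ℝ | (s = 1 ∨ s = -1) ∧ 0 ≤ s * t} := by
  rcases lt_trichotomy t 0 with h | h | h
  · refine Subset.trans ?_ (subset_convexHull ℝ _)
    simp [Sgn, h.not_gt, h.ne, h.le]
  · subst h
    have : {s : ℝ | (s = 1 ∨ s = -1) ∧ 0 ≤ s * 0} = {-1, 1} := by
      ext s
      simp [or_comm]
    rw [this, convexHull_pair, segment_eq_Icc (by norm_num), Sgn_zero]
  · refine Subset.trans ?_ (subset_convexHull ℝ _)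
    simp [Sgn, h]

theorem SgnVec_subset_convexHull (x : Euc n) : SgnVec x ⊆ convexHull ℝ (signVertices x) := by
  rw [SgnVec_eq_image]
  have h1 : (univ.pi fun i => Sgn (x i)) ⊆
      convexHull ℝ (univ.pi fun i => {s : ℝ | (s = 1 ∨ s = -1) ∧ 0 ≤ s * x i}) := by
    rw [convexHull_pi]
    exact pi_mono fun i _ => Sgn_subset_convexHull (x i)
  refine (image_mono h1).trans ?_
  rw [LinearMap.image_convexHull]
  refine convexHull_mono ?_
  rintro _ ⟨z, hz, rfl⟩ i
  exact hz i (mem_univ i)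

theorem sgnVec_eq_of_pos {σ y : Euc n} (hσ : ∀ i, σ i = 1 ∨ σ i = -1)
    (h : ∀ i, 0 < σ i * y i) : sgnVec y = σ := by
  ext i
  show Real.sign (y i) = σ i
  have := h i
  rcases hσ i with h1 | h1
  · rw [h1] at this ⊢
    exact Real.sign_of_pos (by linarith)
  · rw [h1] at this ⊢
    exact Real.sign_of_neg (by linarith)

/-- For small t > 0 the point x + t σ lies in the open orthant of σ. So this orthant meets each
neighbourhood of x in a nonempty open set, which has positive measure and is not covered by N. -/
theorem exists_orthant_point {x σ : Euc n} (hσ : σ ∈ signVertices x) {N : Set (Euc n)}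
    (hN : volume N = 0) {s : Set (Euc n)} (hs : s ∈ 𝓝 x) :
    ∃ y ∈ s \ N, sgnVec y = σ := by
  obtain ⟨O, hOs, hO, hxO⟩ := mem_nhds_iff.1 hs
  have hopen : IsOpen (O ∩ {y : Euc n | ∀ i, 0 < σ i * y i}) := by
    refine hO.inter ?_
    rw [ofPred_forall]
    exact isOpen_iInter_of_finite fun i => isOpen_lt continuous_const
      (continuous_const.mul (PiLp.continuous_apply 2 (fun _ => ℝ) i))
  have hne : (O ∩ {y : Euc n | ∀ i, 0 < σ i * y i}).Nonempty := by
    have h1 : Tendsto (fun t : ℝ => x + t • σ) (𝓝[>] 0) (𝓝 (x + (0 : ℝ) • σ)) :=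
      (Continuous.tendsto (by fun_prop) 0).mono_left nhdsWithin_le_nhds
    rw [zero_smul, add_zero] at h1
    obtain ⟨t, htO, ht⟩ := ((h1.eventually (hO.mem_nhds hxO)).and
      self_mem_nhdsWithin).exists
    refine ⟨_, htO, fun i => ?_⟩
    have ht' : 0 < t := ht
    have e : σ i * (x + t • σ) i = σ i * x i + t * (σ i * σ i) := by
      simp only [PiLp.add_apply, PiLp.smul_apply, smul_eq_mul]
      ring
    have e2 : σ i * σ i = 1 := by rcases (hσ i).1 with h | h <;> simp [h]
    rw [e, e2]
    linarith [(hσ i).2]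
  have hpos := hopen.measure_pos volume hne
  obtain ⟨y, hy, hyN⟩ : ((O ∩ {y : Euc n | ∀ i, 0 < σ i * y i}) \ N).Nonempty := by
    refine nonempty_of_measure_ne_zero (μ := volume) ?_
    rw [measure_sdiff_null hN]
    exact hpos.ne'
  exact ⟨y, ⟨hOs hy.1, hyN⟩, sgnVec_eq_of_pos (fun i => (hσ i).1) hy.2⟩

/-- The σ with g x + A σ in the closed convex hull form a convex set. It contains the adjacent sign
vectors, hence their hull, which contains S(x). -/
theorem subset_filippov {g : Euc n → Euc n} (hg : Continuous g) (x : Euc n) :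
    (fun z => g x + z) '' SwitchTerm A x ⊆ filippov (fun y => g y + switchTerm A y) x := by
  refine subset_iInter₂ fun ε hε => subset_iInter₂ fun N hN => ?_
  set C := closure (convexHull ℝ
    ((fun y => g y + switchTerm A y) '' (Metric.ball x ε \ N))) with hC
  have hCc : Convex ℝ C := (convex_convexHull ℝ _).closure
  have h1 : signVertices x ⊆ (Matrix.toEuclideanLin A) ⁻¹' ((fun z => g x + z) ⁻¹' C) := by
    intro σ hσ
    show g x + Matrix.toEuclideanLin A σ ∈ C
    refine closure_mono (subset_convexHull ℝ _) (Metric.mem_closure_iff.2 fun ρ hρ => ?_)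
    have h2 : ∀ᶠ y in 𝓝 x, dist (g y) (g x) < ρ :=
      (hg.tendsto x).eventually (Metric.ball_mem_nhds _ hρ)
    obtain ⟨y, hy, hyσ⟩ := exists_orthant_point hσ hN
      (inter_mem (Metric.ball_mem_nhds x hε) h2)
    refine ⟨_, mem_image_of_mem _ ⟨hy.1.1, hy.2⟩, ?_⟩
    rw [switchTerm, hyσ, dist_add_right, dist_comm]
    exact hy.1.2
  have h2 := convexHull_min h1 ((hCc.translate_preimage_right (g x)).linear_preimage _)
  rintro _ ⟨_, ⟨σ, hσ, rfl⟩, rfl⟩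
  exact h2 (SgnVec_subset_convexHull x hσ)

/-- The Filippov regularization of `g + A s` is `g + A S`. -/
theorem filippov_eq {g : Euc n → Euc n} (hg : Continuous g) (x : Euc n) :
    filippov (fun y => g y + switchTerm A y) x = (fun z => g x + z) '' SwitchTerm A x :=
  (filippov_subset A hg x).antisymm (subset_filippov A hg x)

/-! ### Approximate selections -/

theorem approxSelection_mem_cthickening {g : Euc n → Euc n} (hg : Continuous g) (y : Euc n)
    {ρ : ℝ} (hρ : 0 < ρ) : ∃ η > 0, ∀ ε ≤ η, ∀ h, IsApproxSelection (SwitchTerm A) ε h →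
      ∀ x, ‖x - y‖ ≤ η →
        g x + h x ∈ Metric.cthickening ρ ((fun z => g y + z) '' SwitchTerm A y) := by
  have h1 : ∀ᶠ x in 𝓝 y, dist (g x) (g y) < ρ / 2 :=
    (hg.tendsto y).eventually (Metric.ball_mem_nhds _ (half_pos hρ))
  obtain ⟨r, hr, h2⟩ := Metric.eventually_nhds_iff.1
    (h1.and (eventually_SwitchTerm_subset A y))
  -- The witness `x'` of the selection property is within 2r/3 of y, so A S(x') ⊆ A S(y); the error
  -- ρ is shared equally by g and h.
  refine ⟨min (r / 3) (ρ / 2), lt_min (by positivity) (by positivity), ?_⟩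
  intro ε hε h hh x hx
  obtain ⟨⟨x', z, hz, hx', hhz⟩, -⟩ := hh x
  have e1 := le_min_iff.1 hε
  have e2 := le_min_iff.1 hx
  have hxy : dist x y < r := by rw [dist_eq_norm]; linarith
  have hxy' : dist x' y < r := by
    have := dist_triangle_left x' y x
    rw [dist_eq_norm x x', dist_eq_norm x y] at this
    linarith
  refine Metric.mem_cthickening_of_dist_le _ (g y + z) _ _
    (mem_image_of_mem _ ((h2 hxy').2 hz)) ?_
  refine (dist_add_add_le _ _ _ _).trans ?_
  rw [dist_eq_norm (h x)]
  linarith [(h2 hxy).1]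

theorem norm_le_of_abs_le {u w : Euc n} {C : ℝ} (hC : 0 ≤ C) (h : ∀ i, |u i| ≤ C * |w i|) :
    ‖u‖ ≤ C * ‖w‖ := by
  rw [EuclideanSpace.norm_eq u]
  refine Real.sqrt_le_iff.2 ⟨by positivity, ?_⟩
  rw [mul_pow, EuclideanSpace.norm_sq_eq, Finset.mul_sum]
  refine Finset.sum_le_sum fun i _ => ?_
  rw [← mul_pow]
  exact pow_le_pow_left₀ (norm_nonneg _) (h i) 2

/-- Coordinatewise saturation. -/
noncomputable def clampVec (r : ℝ) (x : Euc n) : Euc n :=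
  WithLp.toLp 2 fun i => max (-1) (min 1 (x i / r))

theorem lipschitz_clampVec {r : ℝ} (hr : 0 < r) (x y : Euc n) :
    ‖clampVec r x - clampVec r y‖ ≤ r⁻¹ * ‖x - y‖ := by
  refine norm_le_of_abs_le (inv_pos.2 hr).le fun i => ?_
  have h : LipschitzWith 1 fun t : ℝ => max (-1) (min 1 t) :=
    (LipschitzWith.id.const_min 1).const_max (-1)
  have := h.dist_le_mul (x i / r) (y i / r)
  rw [Real.dist_eq, Real.dist_eq, ← sub_div, abs_div, abs_of_pos hr, NNReal.coe_one, one_mul] at this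
  rw [inv_mul_eq_div]
  exact this

theorem clamp_eq_sign {r t : ℝ} (hr : 0 < r) (h : r ≤ |t|) :
    max (-1) (min 1 (t / r)) = Real.sign t := by
  rcases le_abs.1 h with h | h
  · have : 1 ≤ t / r := (one_le_div hr).2 h
    rw [Real.sign_of_pos (hr.trans_le h), min_eq_left this]
    norm_num
  · have : t / r ≤ -1 := by rw [div_le_iff₀ hr]; linarith
    rw [Real.sign_of_neg (by linarith), min_eq_right (by linarith), max_eq_left this]

/-- Coordinates smaller than r are moved to 0, where Sgn is the whole interval; at the others
saturation already equals the sign. -/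
theorem clampVec_mem {r : ℝ} (hr : 0 < r) (x : Euc n) :
    ∃ y : Euc n, (∀ i, |(x - y) i| ≤ r) ∧ clampVec r x ∈ SgnVec y := by
  refine ⟨WithLp.toLp 2 fun i => if |x i| < r then 0 else x i, fun i => ?_, fun i => ?_⟩
  · show |x i - if |x i| < r then 0 else x i| ≤ r
    split_ifs with h
    · rw [sub_zero]; exact h.le
    · rw [sub_self, abs_zero]; exact hr.le
  · show max (-1) (min 1 (x i / r)) ∈ Sgn (if |x i| < r then 0 else x i)
    split_ifs with h
    · rw [Sgn_zero]
      exact ⟨le_max_left _ _, max_le (by norm_num) (min_le_left _ _)⟩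
    · rw [clamp_eq_sign hr (not_lt.1 h)]
      exact sign_mem_Sgn _

/-- A step from x in direction e_i raises the i-th sign from 0 to 1 and changes no other, so A s
jumps by the nonzero column A e_i. -/
theorem mem_switchSet {g : Euc n → Euc n} (hg : Continuous g) {x : Euc n} {i : Fin n}
    (hi : Matrix.toEuclideanLin A (EuclideanSpace.single i 1) ≠ 0) (hx : x i = 0) :
    x ∈ switchSet fun y => g y + switchTerm A y := by
  intro hc
  have hc' : ContinuousAt (switchTerm A) x := by
    refine (hc.sub hg.continuousAt).congr (Eventually.of_forall fun y => ?_)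
    simp
  have h1 : Tendsto (fun t : ℝ => x + t • EuclideanSpace.single i (1 : ℝ)) (𝓝[>] 0)
      (𝓝 (x + (0 : ℝ) • EuclideanSpace.single i (1 : ℝ))) :=
    (Continuous.tendsto (by fun_prop) 0).mono_left nhdsWithin_le_nhds
  rw [zero_smul, add_zero] at h1
  have h2 : ∀ᶠ t : ℝ in 𝓝[>] 0,
      switchTerm A (x + t • EuclideanSpace.single i (1 : ℝ))
        = switchTerm A x + Matrix.toEuclideanLin A (EuclideanSpace.single i 1) := by
    filter_upwards [self_mem_nhdsWithin] with t ht
    rw [switchTerm, switchTerm, ← map_add]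
    congr 1
    ext j
    show Real.sign ((x + t • EuclideanSpace.single i (1 : ℝ)) j)
      = Real.sign (x j) + (EuclideanSpace.single i (1 : ℝ)) j
    by_cases hj : j = i
    · subst hj
      simp [hx, Real.sign_of_pos ht]
    · simp [hj]
  have h3 := tendsto_nhds_unique ((hc'.tendsto.comp h1).congr' h2) tendsto_const_nhds
  exact hi (by simpa using h3)

theorem toEuclideanLin_eq_zero {w : Euc n}
    (h : ∀ i, Matrix.toEuclideanLin A (EuclideanSpace.single i 1) ≠ 0 → w i = 0) :
    Matrix.toEuclideanLin A w = 0 := by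
  have e : w = ∑ i, w i • EuclideanSpace.single i (1 : ℝ) := by
    ext j
    simp [Pi.single_apply]
  rw [e, map_sum]
  refine Finset.sum_eq_zero fun i _ => ?_
  rw [map_smul]
  by_cases hi : Matrix.toEuclideanLin A (EuclideanSpace.single i 1) = 0
  · rw [hi, smul_zero]
  · rw [h i hi, zero_smul]

/-- Locally Lipschitz approximate selections which agree with `A s` away from the switching
set. -/
theorem exists_lipschitz_selection {g : Euc n → Euc n} (hg : Continuous g) {ε : ℝ} (hε : 0 < ε) :
    ∃ h : Euc n → Euc n, LocallyLipschitz h ∧ IsApproxSelection (SwitchTerm A) ε h ∧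
      ∀ x ∉ Metric.thickening ε (switchSet fun y => g y + switchTerm A y),
        h x = switchTerm A x := by
  set W : ℝ := ‖(WithLp.toLp 2 fun _ => 1 : Euc n)‖ with hW
  have hW0 : 0 ≤ W := norm_nonneg _
  -- A coordinatewise error r has Euclidean norm at most r W ≤ ε; the extra 1 also gives r ≤ ε, and
  -- keeps the quotient meaningful if n = 0.
  set r := ε / (W + 1) with hr
  have hr0 : 0 < r := by positivity
  have hrε : r ≤ ε := div_le_self hε.le (by linarith)
  refine ⟨fun x => Matrix.toEuclideanLin A (clampVec r x), ?_, fun x => ?_, fun x hx => ?_⟩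
  · refine LipschitzWith.locallyLipschitz ((LinearMap.toContinuousLinearMap
      (Matrix.toEuclideanLin A)).lipschitz.comp (LipschitzWith.of_dist_le_mul
        (K := r⁻¹.toNNReal) fun x y => ?_))
    rw [dist_eq_norm, dist_eq_norm, Real.coe_toNNReal _ (inv_pos.2 hr0).le]
    exact lipschitz_clampVec hr0 x y
  · obtain ⟨y, hy, hc⟩ := clampVec_mem hr0 x
    have hm := mem_image_of_mem (Matrix.toEuclideanLin A) hc
    refine ⟨⟨y, _, hm, ?_, ?_⟩, subset_convexHull ℝ _ (mem_iUnion.2 ⟨y, hm⟩)⟩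
    · refine (norm_le_of_abs_le (w := WithLp.toLp 2 fun _ => 1) hr0.le fun i => ?_).trans ?_
      · simpa using hy i
      · rw [← hW, hr, div_mul_eq_mul_div, div_le_iff₀ (by positivity)]
        nlinarith
    · rw [sub_self, norm_zero]
      exact hε.le
  · rw [← sub_eq_zero, switchTerm, ← map_sub]
    refine toEuclideanLin_eq_zero A fun i hi => ?_
    -- Zeroing coordinate i gives a switching point at distance |x i|, so |x i| ≥ ε whenever A e_i ≠
    -- 0. Coordinates with A e_i = 0 have no influence.
    have hmem := mem_switchSet A hg (x := x - x i • EuclideanSpace.single i (1 : ℝ)) hi (by simp)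
    have h1 : ε ≤ |x i| := by
      by_contra! hlt
      refine hx (Metric.mem_thickening_iff.2 ⟨_, hmem, ?_⟩)
      rw [dist_eq_norm, sub_sub_cancel, norm_smul]
      simpa using hlt
    show max (-1) (min 1 (x i / r)) - Real.sign (x i) = 0
    rw [clamp_eq_sign hr0 (hrε.trans h1), sub_self]

end SetValued

/-! ### Error analysis of the predictor-corrector scheme -/

/-- Up to a factor, the difference between the weights of the trapezoidal and the rectangle rule
for the kernel, accumulated at distance `y` from the singularity. -/
noncomputable def weightDefect (q y : ℝ) : ℝ :=
  (y + 1) ^ (q + 1) - y ^ (q + 1) - (q + 1) * y ^ q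

theorem weightDefect_eq_integral {q y : ℝ} (hq0 : 0 < q) :
    weightDefect q y = (q + 1) * ∫ u in (0 : ℝ)..1, ((y + u) ^ q - y ^ q) := by
  have hc : Continuous fun u : ℝ => (y + u) ^ q :=
    (continuous_const.add continuous_id).rpow_const fun _ => Or.inr hq0.le
  rw [intervalIntegral.integral_sub (hc.intervalIntegrable _ _) (by simp),
    intervalIntegral.integral_comp_add_left (fun u => u ^ q) y,
    integral_rpow (Or.inl (by linarith)), intervalIntegral.integral_const, weightDefect]
  simp only [add_zero, sub_zero, one_smul]
  field_simp

/-- Both y + u and y + 1 are convex combinations of y and y + 1 + u, with interchanged weights;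
adding the two concavity inequalities gives the claim. -/
theorem rpow_increment_antitone {q y u : ℝ} (hq0 : 0 < q) (hq1 : q ≤ 1) (hy : 0 ≤ y)
    (hu : 0 ≤ u) : (y + 1 + u) ^ q - (y + 1) ^ q ≤ (y + u) ^ q - y ^ q := by
  have hc := Real.concaveOn_rpow hq0.le hq1
  have hpos : 0 < 1 + u := by linarith
  have m1 : y ∈ Ici (0 : ℝ) := hy
  have m2 : y + 1 + u ∈ Ici (0 : ℝ) := mem_Ici.2 (by linarith)
  have hsum : 1 / (1 + u) + u / (1 + u) = 1 := by rw [← add_div, div_self hpos.ne']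
  have e1 := hc.2 m1 m2 (by positivity) (by positivity) hsum
  have e2 := hc.2 m1 m2 (by positivity) (by positivity) ((add_comm _ _).trans hsum)
  have p1 : (1 / (1 + u)) • y + (u / (1 + u)) • (y + 1 + u) = y + u := by
    simp only [smul_eq_mul]
    field_simp
    ring
  have p2 : (u / (1 + u)) • y + (1 / (1 + u)) • (y + 1 + u) = y + 1 := by
    simp only [smul_eq_mul]
    field_simp
    ring
  rw [p1] at e1
  rw [p2] at e2
  simp only [smul_eq_mul] at e1 e2
  have e3 : 1 / (1 + u) = 1 - u / (1 + u) := by linarith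
  rw [e3] at e1 e2
  linarith

theorem weightDefect_antitone {q y : ℝ} (hq0 : 0 < q) (hq1 : q ≤ 1) (hy : 0 ≤ y) :
    weightDefect q (y + 1) ≤ weightDefect q y := by
  rw [weightDefect_eq_integral hq0, weightDefect_eq_integral hq0]
  refine mul_le_mul_of_nonneg_left ?_ (by linarith)
  have hc : ∀ y : ℝ, Continuous fun u : ℝ => (y + u) ^ q - y ^ q := fun y =>
    ((continuous_const.add continuous_id).rpow_const fun _ => Or.inr hq0.le).sub continuous_const
  exact intervalIntegral.integral_mono_on zero_le_one ((hc _).intervalIntegrable _ _)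
    ((hc _).intervalIntegrable _ _) fun u hu => rpow_increment_antitone hq0 hq1 hy hu.1

theorem weightDefect_nonneg {q y : ℝ} (hq0 : 0 < q) (hy : 0 ≤ y) : 0 ≤ weightDefect q y := by
  rw [weightDefect_eq_integral hq0]
  refine mul_nonneg (by linarith) (intervalIntegral.integral_nonneg zero_le_one fun u hu => ?_)
  exact sub_nonneg.2 (Real.rpow_le_rpow hy (by linarith [hu.1]) hq0.le)

theorem weightDefect_zero {q : ℝ} (hq0 : 0 < q) : weightDefect q 0 = 1 := by
  simp [weightDefect, Real.zero_rpow hq0.ne', Real.zero_rpow (by linarith : q + 1 ≠ 0)]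

theorem Gamma_add_two {q : ℝ} (hq0 : 0 < q) :
    Real.Gamma (q + 2) = (q + 1) * (q * Real.Gamma q) := by
  rw [← Real.Gamma_add_one hq0.ne', ← Real.Gamma_add_one (by linarith)]
  ring_nf

theorem dff_weight_zero {q η : ℝ} (hq0 : 0 < q) (m : ℕ) :
    η ^ q / Real.Gamma (q + 2) * dffA q 0 m - (Real.Gamma q)⁻¹ * dffB q η 0 m
      = η ^ q / Real.Gamma (q + 2) * -weightDefect q m := by
  have hG := (Real.Gamma_pos_of_pos hq0).ne'
  have h1 : q + 1 ≠ 0 := by linarith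
  have hm : (0 : ℝ) ≤ m := m.cast_nonneg
  rw [Gamma_add_two hq0, dffA, if_pos rfl, dffB, weightDefect,
    Real.rpow_add_one' hm h1, Real.rpow_add_one' (by linarith : (0 : ℝ) ≤ m + 1) h1]
  simp only [Nat.cast_zero, sub_zero]
  field_simp
  ring

theorem dff_weight_succ {q η : ℝ} (hq0 : 0 < q) {j m : ℕ} (hj : j + 1 ≤ m) :
    η ^ q / Real.Gamma (q + 2) * dffA q (j + 1) m - (Real.Gamma q)⁻¹ * dffB q η (j + 1) m
      = η ^ q / Real.Gamma (q + 2)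
        * -(weightDefect q (m - (j + 1 : ℕ)) - weightDefect q (m - j)) := by
  have hG := (Real.Gamma_pos_of_pos hq0).ne'
  have h1 : q + 1 ≠ 0 := by linarith
  have hm : (0 : ℝ) ≤ m - (j + 1) := by
    have : ((j + 1 : ℕ) : ℝ) ≤ m := Nat.cast_le.2 hj
    push_cast at this
    linarith
  rw [Gamma_add_two hq0, dffA, if_neg (Nat.succ_ne_zero j), dffB, weightDefect, weightDefect]
  push_cast
  obtain ⟨y, hy⟩ : ∃ y : ℝ, y = m - (j + 1) := ⟨_, rfl⟩
  rw [← hy] at hm ⊢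
  have e2 : (m : ℝ) - j = y + 1 := by rw [hy]; ring
  have e3 : (m : ℝ) + 1 - (j + 1) = y + 1 := by rw [hy]; ring
  rw [e2, e3, show y + 1 + 1 = y + 2 by ring, Real.rpow_add_one' hm h1,
    Real.rpow_add_one' (by linarith : (0 : ℝ) ≤ y + 1) h1,
    Real.rpow_add_one' (by linarith : (0 : ℝ) ≤ y + 2) h1]
  field_simp
  ring

/-- The predictor `P_{m+1}` of the scheme. -/
noncomputable def dffPredictor {n : ℕ} (q η : ℝ) (f : Euc n → Euc n) (x₀ : Euc n) (m : ℕ) :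
    Euc n :=
  x₀ + (Real.Gamma q)⁻¹ • ∑ j : Fin (m + 1), dffB q η j m • f (dff q η f x₀ j)

theorem dff_zero {n : ℕ} (q η : ℝ) (f : Euc n → Euc n) (x₀ : Euc n) : dff q η f x₀ 0 = x₀ := by
  rw [dff]

theorem dff_succ {n : ℕ} (q η : ℝ) (f : Euc n → Euc n) (x₀ : Euc n) (m : ℕ) :
    dff q η f x₀ (m + 1) = x₀ + (η ^ q / Real.Gamma (q + 2)) • f (dffPredictor q η f x₀ m)
      + (η ^ q / Real.Gamma (q + 2)) •
        ∑ j : Fin (m + 1), dffA q j m • f (dff q η f x₀ j) := by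
  rw [dff]
  rfl

/-- The weight differences at j ≥ 1 are increments of `weightDefect`, all of one sign, so their
absolute values telescope to 1 - `weightDefect q m`; j = 0 contributes the missing `weightDefect q
m`. Together with the term f(P) this gives the factor 2, independent of m. -/
theorem norm_dff_sub_predictor_le {n : ℕ} {q η : ℝ} (hq0 : 0 < q) (hq1 : q ≤ 1) (hη : 0 ≤ η)
    {f : Euc n → Euc n} {M : ℝ} (hf : ∀ x, ‖f x‖ ≤ M) (x₀ : Euc n) (m : ℕ) :
    ‖dff q η f x₀ (m + 1) - dffPredictor q η f x₀ m‖
      ≤ 2 * M / Real.Gamma (q + 2) * η ^ q := by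
  set c := η ^ q / Real.Gamma (q + 2) with hc
  have hc0 : 0 ≤ c := div_nonneg (Real.rpow_nonneg hη _)
    (Real.Gamma_pos_of_pos (by linarith)).le
  have e1 : dff q η f x₀ (m + 1) - dffPredictor q η f x₀ m
      = c • f (dffPredictor q η f x₀ m)
        + ∑ j ∈ Finset.range (m + 1), (c * dffA q j m - (Real.Gamma q)⁻¹ * dffB q η j m)
            • f (dff q η f x₀ j) := by
    rw [dff_succ, ← hc]
    generalize f (dffPredictor q η f x₀ m) = w
    rw [dffPredictor, Finset.sum_range]
    simp only [sub_smul, Finset.sum_sub_distrib, mul_smul, Finset.smul_sum]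
    abel
  have e2 : ∀ j : ℕ, j + 1 ≤ m → 0 ≤ weightDefect q (m - (j + 1 : ℕ)) - weightDefect q (m - j) := by
    intro j hj
    have hj' : ((j + 1 : ℕ) : ℝ) ≤ m := Nat.cast_le.2 hj
    have := weightDefect_antitone (y := m - (j + 1 : ℕ)) hq0 hq1 (by linarith)
    have e : (m : ℝ) - (j + 1 : ℕ) + 1 = m - j := by push_cast; ring
    rw [e] at this
    linarith
  have hw0 := weightDefect_nonneg (q := q) hq0 (m.cast_nonneg : (0 : ℝ) ≤ m)
  have h0 : ‖(c * dffA q 0 m - (Real.Gamma q)⁻¹ * dffB q η 0 m) • f (dff q η f x₀ 0)‖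
      ≤ c * weightDefect q m * M := by
    rw [hc, dff_weight_zero hq0, ← hc, norm_smul, mul_neg, norm_neg,
      Real.norm_of_nonneg (mul_nonneg hc0 hw0)]
    exact mul_le_mul_of_nonneg_left (hf _) (mul_nonneg hc0 hw0)
  have h1 : ∀ j ∈ Finset.range m,
      ‖(c * dffA q (j + 1) m - (Real.Gamma q)⁻¹ * dffB q η (j + 1) m) • f (dff q η f x₀ (j + 1))‖
        ≤ c * M * (weightDefect q (m - (j + 1 : ℕ)) - weightDefect q (m - j)) := by
    intro j hj
    have hj' : j + 1 ≤ m := Finset.mem_range.1 hj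
    have h2 := mul_nonneg hc0 (e2 j hj')
    rw [hc, dff_weight_succ hq0 hj', ← hc, norm_smul, mul_neg, norm_neg, Real.norm_of_nonneg h2]
    exact (mul_le_mul_of_nonneg_left (hf _) h2).trans_eq (by ring)
  have hsum : ∑ j ∈ Finset.range m, (weightDefect q (m - (j + 1 : ℕ)) - weightDefect q (m - j))
      = 1 - weightDefect q m := by
    rw [Finset.sum_range_sub (fun j : ℕ => weightDefect q ((m : ℝ) - j)), sub_self,
      weightDefect_zero hq0, Nat.cast_zero, sub_zero]
  rw [e1, Finset.sum_range_succ']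
  have h3 : ‖c • f (dffPredictor q η f x₀ m)‖ ≤ c * M := by
    rw [norm_smul, Real.norm_of_nonneg hc0]
    exact mul_le_mul_of_nonneg_left (hf _) hc0
  have h4 := norm_sum_le_of_le _ h1
  rw [← Finset.mul_sum, hsum] at h4
  have h5 : 2 * M / Real.Gamma (q + 2) * η ^ q
      = c * M + (c * M * (1 - weightDefect q m) + c * weightDefect q m * M) := by
    rw [hc]
    ring
  rw [h5]
  exact (norm_add_le _ _).trans (add_le_add h3 ((norm_add_le _ _).trans (add_le_add h4 h0)))

/-- The piecewise constant function through the values of the right-hand side at the iterates. -/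
noncomputable def dffStep {n : ℕ} (q η : ℝ) (f : Euc n → Euc n) (x₀ : Euc n) (s : ℝ) : Euc n :=
  f (dff q η f x₀ ⌊s / η⌋₊)

theorem measurable_dffStep {n : ℕ} (q η : ℝ) (f : Euc n → Euc n) (x₀ : Euc n) :
    Measurable (dffStep q η f x₀) :=
  (measurable_from_nat (f := fun k => f (dff q η f x₀ k))).comp
    (Nat.measurable_floor.comp (measurable_id.div_const η))

/-- The predictor is a product rectangle rule: the kernel is integrated exactly on each cell, where
`dffStep` is constant. -/
theorem dffPredictor_eq {n : ℕ} {q η : ℝ} (hq0 : 0 < q) (hη : 0 < η) {f : Euc n → Euc n} {M : ℝ}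
    (hf : ∀ x, ‖f x‖ ≤ M) (x₀ : Euc n) (m : ℕ) :
    dffPredictor q η f x₀ m
      = x₀ + rlIntegral q (dffStep q η f x₀) (((m + 1 : ℕ) : ℝ) * η) := by
  set t : ℝ := ((m + 1 : ℕ) : ℝ) * η with ht
  rw [dffPredictor, rlIntegral_of_pos hq0]
  congr 2
  have h1 := intervalIntegral.sum_integral_adjacent_intervals (μ := volume) (n := m + 1)
    (a := fun j : ℕ => (j : ℝ) * η) (f := fun s => (t - s) ^ (q - 1) • dffStep q η f x₀ s)
    (fun j _ => (intervalIntegrable_kernel hq0 t _ _).smul_of_bounded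
      (measurable_dffStep q η f x₀) fun s => hf _)
  rw [Nat.cast_zero, zero_mul, ← ht] at h1
  rw [← h1, ← Finset.sum_range fun j => dffB q η j m • f (dff q η f x₀ j)]
  refine Finset.sum_congr rfl fun j hj => ?_
  have hj' : (j : ℝ) ≤ m := Nat.cast_le.2 (Nat.lt_succ_iff.1 (Finset.mem_range.1 hj))
  have hle : (j : ℝ) * η ≤ (j + 1 : ℕ) * η :=
    mul_le_mul_of_nonneg_right (Nat.cast_le.2 j.le_succ) hη.le
  have h2 : ∫ s in (j : ℝ) * η..((j + 1 : ℕ) : ℝ) * η, (t - s) ^ (q - 1) • dffStep q η f x₀ s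
      = ∫ s in (j : ℝ) * η..((j + 1 : ℕ) : ℝ) * η, (t - s) ^ (q - 1) • f (dff q η f x₀ j) := by
    refine intervalIntegral.integral_congr_Ioo_of_le hle fun s hs => ?_
    have hfl : ⌊s / η⌋₊ = j := by
      have hs0 : 0 ≤ s / η := div_nonneg
        ((mul_nonneg j.cast_nonneg hη.le).trans hs.1.le) hη.le
      rw [Nat.floor_eq_iff hs0, le_div_iff₀ hη, div_lt_iff₀ hη]
      have := hs.2
      push_cast at this
      exact ⟨hs.1.le, this⟩
    simp only [dffStep, hfl]
  rw [h2, intervalIntegral.integral_smul_const, integral_kernel hq0]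
  congr 1
  have e1 : t - j * η = η * (m + 1 - j) := by rw [ht]; push_cast; ring
  have e2 : t - (j + 1 : ℕ) * η = η * (m - j) := by rw [ht]; push_cast; ring
  rw [e1, e2, Real.mul_rpow hη.le (by linarith), Real.mul_rpow hη.le (by linarith), dffB]
  ring

theorem norm_dff_sub_le {n : ℕ} {q η : ℝ} (hq0 : 0 < q) (hq1 : q ≤ 1) (hη : 0 < η)
    {f : Euc n → Euc n} {M : ℝ} (hf : ∀ x, ‖f x‖ ≤ M) (x₀ : Euc n) (k : ℕ) :
    ‖dff q η f x₀ k - (x₀ + rlIntegral q (dffStep q η f x₀) ((k : ℝ) * η))‖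
      ≤ 2 * M / Real.Gamma (q + 2) * η ^ q := by
  have hM : 0 ≤ M := (norm_nonneg _).trans (hf 0)
  cases k with
  | zero =>
    rw [dff_zero, Nat.cast_zero, zero_mul, rlIntegral_at_zero hq0, add_zero, sub_self, norm_zero]
    have := Real.Gamma_pos_of_pos (by linarith : 0 < q + 2)
    positivity
  | succ m =>
    rw [← dffPredictor_eq hq0 hη hf]
    exact norm_dff_sub_predictor_le hq0 hq1 hη.le hf x₀ m

theorem isVolterra_dffStep {n : ℕ} {q : ℝ} (η T : ℝ) {f : Euc n → Euc n} {M : ℝ}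
    (hf : ∀ x, ‖f x‖ ≤ M) (x₀ : Euc n) :
    IsVolterra q x₀ T M (dffStep q η f x₀) fun t => x₀ + rlIntegral q (dffStep q η f x₀) t :=
  ⟨measurable_dffStep q η f x₀, fun _ => hf _, fun _ _ => rfl⟩

theorem norm_dff_floor_sub_le {n : ℕ} {q η : ℝ} (hq0 : 0 < q) (hq1 : q ≤ 1) (hη : 0 < η)
    {f : Euc n → Euc n} {M : ℝ} (hf : ∀ x, ‖f x‖ ≤ M) (x₀ : Euc n) {s : ℝ} (hs : 0 ≤ s) :
    ‖dff q η f x₀ ⌊s / η⌋₊ - (x₀ + rlIntegral q (dffStep q η f x₀) s)‖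
      ≤ (2 * M / Real.Gamma (q + 2) + 2 * M / Real.Gamma (q + 1)) * η ^ q := by
  have hM : 0 ≤ M := (norm_nonneg _).trans (hf 0)
  set j := ⌊s / η⌋₊ with hj
  have h1 : (j : ℝ) * η ≤ s := (le_div_iff₀ hη).1 (Nat.floor_le (div_nonneg hs hη.le))
  have h2 : s < ((j : ℝ) + 1) * η := (div_lt_iff₀ hη).1 (Nat.lt_floor_add_one _)
  have h3 := (isVolterra_dffStep (q := q) η s hf x₀).norm_sub_le hq0 hq1 (s := s) (t := j * η)
    ⟨hs, le_rfl⟩ ⟨mul_nonneg j.cast_nonneg hη.le, h1⟩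
  have h4 : |(j : ℝ) * η - s| ^ q ≤ η ^ q := by
    refine Real.rpow_le_rpow (abs_nonneg _) ?_ hq0.le
    rw [abs_sub_comm, abs_of_nonneg (by linarith)]
    linarith
  have h5 : 0 ≤ 2 * M / Real.Gamma (q + 1) :=
    div_nonneg (by linarith) (Real.Gamma_pos_of_pos (by linarith)).le
  rw [add_mul]
  refine (norm_sub_le_norm_sub_add_norm_sub _ _ _).trans
    (add_le_add (norm_dff_sub_le hq0 hq1 hη hf x₀ j) (h3.trans (mul_le_mul_of_nonneg_left h4 h5)))

theorem grid_mem {T : ℝ} (hT : 0 ≤ T) {N k : ℕ} (hN : 0 < N) (hk : k ≤ N) :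
    (k : ℝ) * (T / N) ∈ Icc 0 T := by
  have hNR : (0 : ℝ) < N := Nat.cast_pos.2 hN
  refine ⟨by positivity, ?_⟩
  rw [mul_div_assoc', div_le_iff₀ hNR, mul_comm]
  exact mul_le_mul_of_nonneg_left (Nat.cast_le.2 hk) hT

theorem eventually_rpow_step_le {q : ℝ} (hq0 : 0 < q) {T : ℝ} (hT : 0 < T) (C : ℝ) {ρ : ℝ}
    (hρ : 0 < ρ) : ∀ᶠ N : ℕ in atTop, 0 < T / N ∧ C * (T / N) ^ q ≤ ρ := by
  obtain ⟨θ, hθ, h⟩ := exists_holder_modulus hq0 C hρ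
  have h1 := (tendsto_const_div_atTop_nhds_zero_nat T).eventually_lt_const hθ
  filter_upwards [h1, eventually_gt_atTop 0] with N hN hN0
  have hpos : 0 < T / N := div_pos hT (Nat.cast_pos.2 hN0)
  have := h (T / N) (by rwa [abs_of_pos hpos])
  rw [abs_of_pos hpos] at this
  exact ⟨hpos, this⟩

theorem exists_ultrafilter_of_frequently {ι : Type*} {l : Filter ι} {p : ι → Prop}
    (h : ∃ᶠ k in l, p k) : ∃ U : Ultrafilter ι, (U : Filter ι) ≤ l ∧ ∀ᶠ k in (U : Filter ι), p k := by
  have : (l ⊓ 𝓟 {k | p k}).NeBot := frequently_mem_iff_neBot.1 h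
  have hU := Ultrafilter.of_le (l ⊓ 𝓟 {k | p k})
  exact ⟨_, hU.trans inf_le_left, le_principal_iff.1 (hU.trans inf_le_right)⟩

/-- Convergence of the scheme to the set of solutions: bounded continuous right-hand sides. -/
theorem dff_converges_of_bounded {n : ℕ} {q : ℝ} (hq0 : 0 < q) (hq1 : q ≤ 1) {f : Euc n → Euc n}
    (hfc : Continuous f) {M : ℝ} (hf : ∀ x, ‖f x‖ ≤ M) (x₀ : Euc n) {T : ℝ} (hT : 0 < T) {δ : ℝ}
    (hδ : 0 < δ) : ∀ᶠ N : ℕ in atTop, ∃ x, IsCaputoSol q f x₀ T x ∧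
      DffWithin q f x₀ T N δ x ∧
      ∀ m < N, ‖dffPredictor q (T / N) f x₀ m - x ((m + 1 : ℕ) * (T / N))‖ ≤ δ := by
  -- An ultrafilter on the bad N yields a limit solution, which some bad N must approximate after
  -- all.
  by_contra hcon
  rw [not_eventually] at hcon
  obtain ⟨U, hUt, hbad⟩ := exists_ultrafilter_of_frequently hcon
  set y : ℕ → ℝ → Euc n := fun N t => x₀ + rlIntegral q (dffStep q (T / N) f x₀) t with hy
  have hV : ∀ᶠ N : ℕ in (U : Filter ℕ), IsVolterra q x₀ T M (dffStep q (T / N) f x₀) (y N) :=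
    Eventually.of_forall fun N => isVolterra_dffStep _ T hf x₀
  have hsol : IsCaputoSol q f x₀ T (ultraLim U y) := by
    refine ultraLim_isCaputoSol hq0 hq1 hV hT.le hfc
      (fun N s => dff q (T / N) f x₀ ⌊s / (T / N)⌋₊) (Eventually.of_forall fun N s _ => rfl) ?_
    intro ρ hρ
    filter_upwards [hUt (eventually_rpow_step_le hq0 hT
      (2 * M / Real.Gamma (q + 2) + 2 * M / Real.Gamma (q + 1)) hρ)] with N hN s hs
    exact (norm_dff_floor_sub_le hq0 hq1 hN.1 hf x₀ hs.1).trans hN.2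
  have hgood := ultraLim_uniform hq0 hq1 hV (half_pos hδ)
  obtain ⟨N, hN1, hN2, hN3⟩ := (hbad.and (hgood.and (hUt (eventually_rpow_step_le hq0 hT
    (2 * M / Real.Gamma (q + 2)) (half_pos hδ))))).exists
  -- N = 0 would make the step T / 0 = 0, against the positivity in `hN3`.
  have hNpos : 0 < N := by
    by_contra h0
    have : N = 0 := by omega
    simp [this] at hN3
  refine hN1 ⟨_, hsol, fun k hk => ?_, fun m hm => ?_⟩
  · have h1 := (norm_dff_sub_le hq0 hq1 hN3.1 hf x₀ k).trans hN3.2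
    have h2 := hN2 _ (grid_mem hT.le hNpos hk)
    refine (norm_sub_le_norm_sub_add_norm_sub _ (y N (k * (T / N))) _).trans ?_
    linarith
  -- Predictors are tracked too because f is evaluated at them, which matters when the cutoff is
  -- removed.
  · rw [dffPredictor_eq hq0 hN3.1 hf]
    exact (hN2 _ (grid_mem hT.le hNpos hm)).trans (by linarith)

/-! ### A priori bounds and uniqueness -/

theorem exists_first_exit {T c : ℝ} {φ : ℝ → ℝ} (hφ : ContinuousOn φ (Icc 0 T)) (h0 : φ 0 < c)
    {t : ℝ} (ht : t ∈ Icc 0 T) (hc : c ≤ φ t) :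
    ∃ τ ∈ Ioc 0 T, φ τ = c ∧ ∀ s ∈ Icc 0 τ, φ s ≤ c := by
  have hcl : IsClosed (Icc 0 T ∩ φ ⁻¹' Ici c) :=
    hφ.preimage_isClosed_of_isClosed isClosed_Icc isClosed_Ici
  obtain ⟨τ, ⟨hτT, hτc⟩, hmin⟩ := (isCompact_Icc.of_isClosed_subset hcl
    inter_subset_left).exists_isLeast ⟨t, ht, hc⟩
  have hlt : ∀ s ∈ Icc 0 τ, s < τ → φ s < c := fun s hs hsτ => by
    by_contra! h
    exact absurd (hmin ⟨⟨hs.1, hs.2.trans hτT.2⟩, h⟩) (not_le.2 hsτ)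
  have hsub : Icc 0 τ ⊆ Icc 0 T := Icc_subset_Icc_right hτT.2
  obtain ⟨s, hs, hsc⟩ := intermediate_value_Icc hτT.1 (hφ.mono hsub) ⟨h0.le, hτc⟩
  have hsτ : s = τ := (hs.2.lt_or_eq).resolve_left fun h => (hlt s hs h).ne hsc
  subst hsτ
  have hpos : s ≠ 0 := fun h => by rw [h] at hsc; exact h0.ne hsc
  refine ⟨s, ⟨lt_of_le_of_ne hτT.1 hpos.symm, hτT.2⟩, hsc, fun r hr => ?_⟩
  rcases hr.2.lt_or_eq with h | h
  · exact (hlt r hr h).le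
  · rw [h, hsc]

section

variable {n : ℕ} {q : ℝ} {x₀ : Euc n}

theorem IsCaputoSol.mono {f : Euc n → Euc n} {T T' : ℝ} {x : ℝ → Euc n}
    (h : IsCaputoSol q f x₀ T x) (hT : T' ≤ T) : IsCaputoSol q f x₀ T' x :=
  have hsub : Icc 0 T' ⊆ Icc 0 T := Icc_subset_Icc_right hT
  ⟨h.cont.mono hsub, h.init, fun t ht => (h.eqn t (hsub ht)).mono hsub⟩

theorem IsCaputoSol.congr_rhs {f f' : Euc n → Euc n} {T : ℝ} {x : ℝ → Euc n}
    (h : IsCaputoSol q f x₀ T x) (hf : ∀ t ∈ Icc 0 T, f (x t) = f' (x t)) :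
    IsCaputoSol q f' x₀ T x :=
  ⟨h.cont, h.init, fun t ht => hf t ht ▸ h.eqn t ht⟩

theorem Continuous.exists_bound_closedBall {g : Euc n → Euc n} (hg : Continuous g) (c : Euc n)
    (r : ℝ) : ∃ G, 0 ≤ G ∧ ∀ x, ‖x - c‖ ≤ r → ‖g x‖ ≤ G := by
  obtain ⟨G, hG⟩ := (isCompact_closedBall c r).exists_bound_of_continuousOn hg.continuousOn
  exact ⟨max G 0, le_max_right _ _, fun x hx =>
    (hG x (mem_closedBall_iff_norm.2 hx)).trans (le_max_left _ _)⟩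

/-- `x` solves a Volterra equation whose right-hand side is dominated by `‖g(x)‖ + L`. -/
def IsDominated (q : ℝ) (g : Euc n → Euc n) (L : ℝ) (x₀ : Euc n) (T : ℝ) (x : ℝ → Euc n) :
    Prop :=
  ∃ v M, IsVolterra q x₀ T M v x ∧ ∀ᵐ s : ℝ, s ∈ Icc 0 T → ‖v s‖ ≤ ‖g (x s)‖ + L

theorem IsCaputoSol.isDominated (hq0 : 0 < q) (hq1 : q ≤ 1) {g h : Euc n → Euc n}
    (hg : Continuous g) (hh : Continuous h) {L : ℝ} (hL : ∀ x, ‖h x‖ ≤ L) {T : ℝ} (hT : 0 < T)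
    {x : ℝ → Euc n} (hx : IsCaputoSol q (fun y => g y + h y) x₀ T x) :
    IsDominated q g L x₀ T x := by
  obtain ⟨M, -, hM⟩ := exists_norm_bound ((hg.add hh).comp_continuousOn hx.cont)
  obtain ⟨v, hV, hv⟩ := hx.exists_isVolterra hq0 hq1 (hg.add hh) hT hM
  refine ⟨v, M, hV, ae_of_all _ fun s hs => ?_⟩
  rw [hv s hs]
  exact (norm_add_le _ _).trans (add_le_add_right (hL _) _)

theorem IsInclusionSol.isDominated (hq0 : 0 < q) (hq1 : q ≤ 1) {g : Euc n → Euc n}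
    (hg : Continuous g) {F : Euc n → Set (Euc n)} {L : ℝ} (hL0 : 0 ≤ L)
    (hL : ∀ x, ∀ z ∈ F x, ‖z‖ ≤ ‖g x‖ + L) {T : ℝ} (hT : 0 < T)
    {x : ℝ → Euc n} (hx : IsInclusionSol q F x₀ T x) : IsDominated q g L x₀ T x := by
  obtain ⟨M, hM0, hM⟩ := exists_norm_bound (hg.comp_continuousOn hx.cont)
  obtain ⟨v, hV, hv⟩ := hx.exists_isVolterra hq0 hq1 hT (add_nonneg hM0 hL0)
    fun t ht z hz => (hL _ z hz).trans (add_le_add_left (hM t ht) L)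
  exact ⟨v, M + L, hV, hv.mono fun s hs hsT => hL _ _ (hs hsT)⟩

theorem IsDominated.norm_sub_le (hq0 : 0 < q) {g : Euc n → Euc n} {L : ℝ} {T : ℝ}
    {x : ℝ → Euc n} (hx : IsDominated q g L x₀ T x) {t : ℝ} (ht : t ∈ Icc 0 T)
    {φ : ℝ → ℝ} (hφ : ∀ s ∈ Icc 0 t, ‖g (x s)‖ + L ≤ φ s)
    (hφi : IntervalIntegrable (fun s => (t - s) ^ (q - 1) * φ s) volume 0 t) :
    ‖x t - x₀‖ ≤ (Real.Gamma q)⁻¹ * ∫ s in (0 : ℝ)..t, (t - s) ^ (q - 1) * φ s := by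
  obtain ⟨v, M, hV, hv⟩ := hx
  rw [hV.eqn t ht, add_sub_cancel_left]
  refine norm_rlIntegral_le_integral hq0 ht.1 ?_ hφi
  filter_upwards [hv] with s hs hst
  exact (hs ⟨hst.1.le, hst.2.trans ht.2⟩).trans (hφ s (Ioc_subset_Icc_self hst))

theorem IsDominated.continuousOn (hq0 : 0 < q) (hq1 : q ≤ 1) {g : Euc n → Euc n} {L : ℝ} {T : ℝ}
    {x : ℝ → Euc n} (hx : IsDominated q g L x₀ T x) : ContinuousOn x (Icc 0 T) := by
  obtain ⟨v, M, hV, -⟩ := hx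
  exact hV.continuousOn hq0 hq1

theorem IsDominated.init (hq0 : 0 < q) {g : Euc n → Euc n} {L : ℝ} {T : ℝ} (hT : 0 ≤ T)
    {x : ℝ → Euc n} (hx : IsDominated q g L x₀ T x) : x 0 = x₀ := by
  obtain ⟨v, M, hV, -⟩ := hx
  exact hV.init hq0 hT

/-- Until the first exit from the unit ball about x₀ the right-hand side is at most G + L, so the
displacement is at most (G + L) τ^q / Γ(q + 1) ≤ 1/2. The time depends on the selections only
through L. -/
theorem exists_noBlowUp_isDominated (hq0 : 0 < q) (hq1 : q ≤ 1) {g : Euc n → Euc n}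
    (hg : Continuous g) (L : ℝ) (x₀ : Euc n) :
    ∃ T > 0, NoBlowUp (IsDominated q g L x₀) T := by
  obtain ⟨G, hG0, hG⟩ := hg.exists_bound_closedBall x₀ 1
  obtain ⟨θ, hθ, hm⟩ := exists_holder_modulus hq0 ((G + L) / Real.Gamma (q + 1)) (ρ := 1 / 2)
    (by norm_num)
  refine ⟨θ / 2, by positivity, ‖x₀‖ + 1, fun T hT x hx t ht => ?_⟩
  suffices h : ‖x t - x₀‖ < 1 by
    have := norm_le_norm_add_norm_sub x₀ (x t)
    rw [norm_sub_rev] at this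
    linarith
  by_contra! hcon
  have h0 : ‖x 0 - x₀‖ < 1 := by rw [hx.init hq0 hT.1.le]; simp
  obtain ⟨τ, hτ, hτ1, hle⟩ := exists_first_exit (φ := fun s => ‖x s - x₀‖)
    ((hx.continuousOn hq0 hq1).sub continuousOn_const).norm h0 ht hcon
  have h1 := hx.norm_sub_le hq0 ⟨hτ.1.le, hτ.2⟩ (φ := fun _ => G + L)
    (fun s hs => add_le_add_left (hG _ (hle s hs)) L)
    ((intervalIntegrable_kernel hq0 τ 0 τ).mul_const _)
  rw [intervalIntegral.integral_mul_const, integral_kernel hq0, sub_self, sub_zero,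
    Real.zero_rpow hq0.ne', sub_zero, ← mul_assoc, Gamma_inv_mul_div hq0, hτ1] at h1
  have h2 := hm τ (by rw [abs_of_pos hτ.1]; linarith [hτ.2, hT.2])
  rw [abs_of_pos hτ.1] at h2
  have e : (G + L) / Real.Gamma (q + 1) * τ ^ q = τ ^ q / Real.Gamma (q + 1) * (G + L) := by ring
  rw [e] at h2
  linarith

theorem noBlowUp_isDominated_of_linear (hq0 : 0 < q) (hq1 : q ≤ 1) {g : Euc n → Euc n}
    {L : ℝ} (hL0 : 0 ≤ L) (x₀ : Euc n) {C : ℝ}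
    (hC : ∀ x, ‖g x‖ ≤ C * (1 + ‖x‖)) (T : ℝ) : NoBlowUp (IsDominated q g L x₀) T := by
  have hΓ := Real.Gamma_pos_of_pos hq0
  have hC0 : 0 ≤ C := by
    have := (norm_nonneg _).trans (hC 0)
    simpa using this
  obtain ⟨lam, hl, hgr⟩ := exists_gronwall (b := (Real.Gamma q)⁻¹ * (C + 1)) hq0 (by positivity)
  -- Gronwall is applied to ‖x‖ + 1 + L, since ‖g x‖ + L ≤ (C + 1)(‖x‖ + 1 + L) makes the estimate
  -- homogeneous.
  set a := ‖x₀‖ + 1 + L with ha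
  refine ⟨2 * a * Real.exp (lam * T), fun T' hT' x hx t ht => ?_⟩
  have hc := hx.continuousOn hq0 hq1
  have hφ : ContinuousOn (fun s => ‖x s‖ + 1 + L) (Icc 0 T') :=
    (hc.norm.add continuousOn_const).add continuousOn_const
  have h1 := hgr a T' (fun s => ‖x s‖ + 1 + L) (by positivity) hφ (fun t ht => by
    have hi : IntervalIntegrable (fun s => (t - s) ^ (q - 1) * ((C + 1) * (‖x s‖ + 1 + L)))
        volume 0 t := by
      refine (intervalIntegrable_kernel hq0 t 0 t).mul_continuousOn
        (continuousOn_const.mul (hφ.mono ?_))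
      rw [uIcc_of_le ht.1]
      exact Icc_subset_Icc_right ht.2
    have h2 := hx.norm_sub_le hq0 ht (fun s _ => by
      have := hC (x s)
      nlinarith [norm_nonneg (x s), mul_nonneg hC0 hL0]) hi
    simp only [mul_left_comm _ (C + 1)] at h2
    rw [intervalIntegral.integral_const_mul, ← mul_assoc] at h2
    have h3 := norm_le_norm_add_norm_sub x₀ (x t)
    rw [norm_sub_rev] at h3
    rw [ha]
    linarith) t ht
  have h4 : Real.exp (lam * t) ≤ Real.exp (lam * T) :=
    Real.exp_le_exp.2 (mul_le_mul_of_nonneg_left (ht.2.trans hT'.2) hl.le)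
  have h5 := mul_le_mul_of_nonneg_left h4 (by positivity : 0 ≤ 2 * a)
  linarith

theorem NoBlowUp.imp {Sol Sol' : ℝ → (ℝ → Euc n) → Prop} {T : ℝ} (h : NoBlowUp Sol T)
    (himp : ∀ T' > 0, ∀ x, Sol' T' x → Sol T' x) : NoBlowUp Sol' T := by
  obtain ⟨R, hR⟩ := h
  exact ⟨R, fun T' hT' x hx => hR T' hT' x (himp T' hT'.1 x hx)⟩

/-- Both solutions stay in one ball, on which f is Lipschitz; Gronwall with a = 0 makes their
difference vanish. -/
theorem IsCaputoSol.unique (hq0 : 0 < q) (hq1 : q ≤ 1) {f : Euc n → Euc n}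
    (hf : LocallyLipschitz f) {T : ℝ} (hT : 0 < T) {x y : ℝ → Euc n}
    (hx : IsCaputoSol q f x₀ T x) (hy : IsCaputoSol q f x₀ T y) : EqOn y x (Icc 0 T) := by
  obtain ⟨R₁, -, hR₁⟩ := exists_norm_bound hx.cont
  obtain ⟨R₂, -, hR₂⟩ := exists_norm_bound hy.cont
  obtain ⟨K, hK⟩ := (hf.locallyLipschitzOn (s := Metric.closedBall 0 (max R₁ R₂)))
    |>.exists_lipschitzOnWith_of_compact (isCompact_closedBall _ _)
  obtain ⟨M₁, -, hM₁⟩ := exists_norm_bound (hf.continuous.comp_continuousOn hx.cont)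
  obtain ⟨M₂, -, hM₂⟩ := exists_norm_bound (hf.continuous.comp_continuousOn hy.cont)
  obtain ⟨v, hV, hv⟩ := hx.exists_isVolterra hq0 hq1 hf.continuous hT hM₁
  obtain ⟨w, hW, hw⟩ := hy.exists_isVolterra hq0 hq1 hf.continuous hT hM₂
  have hΓ := Real.Gamma_pos_of_pos hq0
  obtain ⟨lam, -, hgr⟩ := exists_gronwall (b := (Real.Gamma q)⁻¹ * K) hq0 (by positivity)
  have hφ : ContinuousOn (fun s => ‖y s - x s‖) (Icc 0 T) := (hy.cont.sub hx.cont).norm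
  have h1 := hgr 0 T (fun s => ‖y s - x s‖) le_rfl hφ (fun t ht => by
    have hi : IntervalIntegrable (fun s => (t - s) ^ (q - 1) * (K * ‖y s - x s‖)) volume 0 t := by
      refine (intervalIntegrable_kernel hq0 t 0 t).mul_continuousOn
        (continuousOn_const.mul (hφ.mono ?_))
      rw [uIcc_of_le ht.1]
      exact Icc_subset_Icc_right ht.2
    beta_reduce
    rw [hW.eqn t ht, hV.eqn t ht, add_sub_add_left_eq_sub,
      ← rlIntegral_sub hq0.le hW.meas hV.meas hW.bound hV.bound]
    refine (norm_rlIntegral_le_integral hq0 ht.1 (ae_of_all _ fun s hs => ?_) hi).trans ?_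
    · have hsT : s ∈ Icc 0 T := ⟨hs.1.le, hs.2.trans ht.2⟩
      rw [hw s hsT, hv s hsT, ← dist_eq_norm, ← dist_eq_norm]
      refine hK.dist_le_mul _ ?_ _ ?_
      · exact mem_closedBall_zero_iff.2 ((hR₂ s hsT).trans (le_max_right _ _))
      · exact mem_closedBall_zero_iff.2 ((hR₁ s hsT).trans (le_max_left _ _))
    · simp only [mul_left_comm _ (K : ℝ)]
      rw [intervalIntegral.integral_const_mul, ← mul_assoc, zero_add])
  intro t ht
  have := h1 t ht
  rw [mul_zero, zero_mul] at this
  exact sub_eq_zero.1 (norm_le_zero_iff.1 this)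

/-! ### Removing the boundedness assumption -/

/-- A bounded continuous modification of `f` away from a large ball. -/
noncomputable def cutoff (R : ℝ) (f : Euc n → Euc n) (x : Euc n) : Euc n :=
  max 0 (min 1 (R + 2 - ‖x‖)) • f x

theorem continuous_cutoff (R : ℝ) {f : Euc n → Euc n} (hf : Continuous f) :
    Continuous (cutoff R f) := by
  unfold cutoff
  fun_prop

theorem cutoff_eq {R : ℝ} (f : Euc n → Euc n) {x : Euc n} (hx : ‖x‖ ≤ R + 1) :
    cutoff R f x = f x := by
  rw [cutoff, min_eq_left (by linarith), max_eq_right zero_le_one, one_smul]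

theorem exists_cutoff_bound (R : ℝ) {f : Euc n → Euc n} (hf : Continuous f) :
    ∃ M, ∀ x, ‖cutoff R f x‖ ≤ M := by
  obtain ⟨M, hM0, hM⟩ := hf.exists_bound_closedBall 0 (R + 2)
  refine ⟨M, fun x => ?_⟩
  rw [cutoff, norm_smul, Real.norm_of_nonneg (le_max_left _ _)]
  by_cases hx : ‖x‖ ≤ R + 2
  · exact (mul_le_of_le_one_left (norm_nonneg _) (max_le zero_le_one (min_le_left _ _))).trans
      (hM x (by rwa [sub_zero]))
  · rw [min_eq_right (by linarith), max_eq_left (by linarith), zero_mul]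
    exact hM0

/-- Until its norm first reaches R + 1, a solution of the modified problem solves the original one
and is therefore bounded by R, so the norm never gets there. -/
theorem IsCaputoSol.of_cutoff {f : Euc n → Euc n} {R T : ℝ}
    (hR : ∀ T' ∈ Ioc 0 T, ∀ x, IsCaputoSol q f x₀ T' x → ∀ t ∈ Icc 0 T', ‖x t‖ ≤ R)
    (hx₀ : ‖x₀‖ ≤ R) (hT : 0 < T) {x : ℝ → Euc n} (hx : IsCaputoSol q (cutoff R f) x₀ T x) :
    IsCaputoSol q f x₀ T x ∧ ∀ t ∈ Icc 0 T, ‖x t‖ ≤ R := by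
  have hlt : ∀ t ∈ Icc 0 T, ‖x t‖ ≤ R + 1 := by
    intro t ht
    by_contra! hcon
    obtain ⟨τ, hτ, hτ1, hle⟩ := exists_first_exit hx.cont.norm
      (by rw [hx.init]; linarith) ht hcon.le
    have := hR τ hτ x ((hx.mono hτ.2).congr_rhs fun t ht => cutoff_eq f (hle t ht)) τ
      ⟨hτ.1.le, le_rfl⟩
    linarith
  have h := hx.congr_rhs fun t ht => cutoff_eq f (hlt t ht)
  exact ⟨h, hR T ⟨hT, le_rfl⟩ x h⟩

theorem dff_congr {q η : ℝ} {f f' : Euc n → Euc n} {N : ℕ}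
    (hX : ∀ k ≤ N, f (dff q η f' x₀ k) = f' (dff q η f' x₀ k))
    (hP : ∀ m < N, f (dffPredictor q η f' x₀ m) = f' (dffPredictor q η f' x₀ m)) :
    ∀ k ≤ N, dff q η f x₀ k = dff q η f' x₀ k := by
  intro k
  induction k using Nat.strong_induction_on with
  | _ k ih =>
    intro hk
    cases k with
    | zero => rw [dff_zero, dff_zero]
    | succ m =>
      have h1 : ∀ j : Fin (m + 1), f (dff q η f x₀ j) = f' (dff q η f' x₀ j) := fun j => by
        have hj : (j : ℕ) ≤ N := j.isLt.le.trans hk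
        rw [ih j j.isLt hj, hX j hj]
      have h2 : dffPredictor q η f x₀ m = dffPredictor q η f' x₀ m := by
        simp only [dffPredictor, h1]
      rw [dff_succ, dff_succ, h2, hP m hk]
      simp only [h1]

/-- Convergence of the scheme to the set of solutions in the absence of blow-up. -/
theorem dff_converges (hq0 : 0 < q) (hq1 : q ≤ 1) {f : Euc n → Euc n} (hf : Continuous f) {T : ℝ}
    (hT : 0 < T) (hb : NoBlowUp (IsCaputoSol q f x₀) T) {δ : ℝ} (hδ : 0 < δ) :
    ∀ᶠ N : ℕ in atTop, ∃ x, IsCaputoSol q f x₀ T x ∧ DffWithin q f x₀ T N δ x := by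
  obtain ⟨R₀, hR₀⟩ := hb
  set R := max R₀ ‖x₀‖ with hRdef
  have hR : ∀ T' ∈ Ioc 0 T, ∀ x, IsCaputoSol q f x₀ T' x → ∀ t ∈ Icc 0 T', ‖x t‖ ≤ R :=
    fun T' hT' x hx t ht => (hR₀ T' hT' x hx t ht).trans (le_max_left _ _)
  obtain ⟨M, hM⟩ := exists_cutoff_bound R hf
  -- Accuracy 1 around a solution bounded by R keeps all iterates and predictors in the ball of
  -- radius R + 1, where the cutoff is inactive and both schemes agree.
  filter_upwards [dff_converges_of_bounded hq0 hq1 (continuous_cutoff R hf) hM x₀ hT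
    (lt_min hδ one_pos), eventually_gt_atTop 0] with N ⟨x, hx, hX, hP⟩ hN
  obtain ⟨hsol, hxR⟩ := hx.of_cutoff hR (le_max_right _ _) hT
  have hclose : ∀ (w : Euc n) (k : ℕ), k ≤ N → ‖w - x (k * (T / N))‖ ≤ min δ 1 →
      f w = cutoff R f w := fun w k hk hw => by
    refine (cutoff_eq f ?_).symm
    have := norm_le_norm_add_norm_sub (x (k * (T / N))) w
    rw [norm_sub_rev] at this
    linarith [hxR _ (grid_mem hT.le hN hk), hw.trans (min_le_right _ _)]
  have heq := dff_congr (fun k hk => hclose _ k hk (hX k hk))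
    fun m hm => hclose _ (m + 1) hm (hP m hm)
  refine ⟨x, hsol, fun k hk => ?_⟩
  rw [heq k hk]
  exact (hX k hk).trans (min_le_left _ _)

/-- Solvability on the half-line. -/
theorem exists_global_isCaputoSol (hq0 : 0 < q) (hq1 : q ≤ 1) {f : Euc n → Euc n}
    (hf : Continuous f) (hb : ∀ T > 0, NoBlowUp (IsCaputoSol q f x₀) T) :
    ∃ x, ∀ T > 0, IsCaputoSol q f x₀ T x := by
  have hex : ∀ k : ℕ, ∃ x, IsCaputoSol q f x₀ (k + 1) x := fun k => by
    have hk : (0 : ℝ) < k + 1 := by positivity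
    obtain ⟨N, x, hx, -⟩ := (dff_converges hq0 hq1 hf hk (hb _ hk) one_pos).exists
    exact ⟨x, hx⟩
  choose x hx using hex
  -- A single ultrafilter serves every T, so the limit is one function on the half-line; no diagonal
  -- sequence is needed.
  obtain ⟨U, hU⟩ : ∃ U : Ultrafilter ℕ, (U : Filter ℕ) ≤ atTop := ⟨_, Ultrafilter.of_le atTop⟩
  refine ⟨ultraLim U x, fun T hT => ?_⟩
  obtain ⟨R, hR⟩ := hb T hT
  obtain ⟨M, -, hM⟩ := hf.exists_bound_closedBall 0 R
  have hv : ∀ k : ℕ, ∃ v, T ≤ k + 1 →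
      IsVolterra q x₀ T M v (x k) ∧ ∀ t ∈ Icc 0 T, v t = f (x k t) := fun k => by
    by_cases hk : T ≤ k + 1
    · have hxT := (hx k).mono hk
      obtain ⟨v, hv⟩ := hxT.exists_isVolterra hq0 hq1 hf hT fun t ht =>
        hM _ (by rw [sub_zero]; exact hR T ⟨hT, le_rfl⟩ _ hxT t ht)
      exact ⟨v, fun _ => hv⟩
    · exact ⟨0, fun h => absurd h hk⟩
  choose v hv using hv
  have hlarge : ∀ᶠ k : ℕ in (U : Filter ℕ), T ≤ k + 1 := by
    refine hU ?_
    filter_upwards [eventually_ge_atTop ⌈T⌉₊] with k hk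
    have := Nat.ceil_le.1 hk
    linarith
  exact ultraLim_isCaputoSol hq0 hq1 (hlarge.mono fun k hk => (hv k hk).1) hT.le hf x
    (hlarge.mono fun k hk => (hv k hk).2)
    fun ρ hρ => Eventually.of_forall fun k s _ => by rw [sub_self, norm_zero]; exact hρ.le

end

/-! ### Vanishing tolerance: convergence to Filippov solutions -/

section

variable {n : ℕ} {q : ℝ} {x₀ : Euc n} {A : Matrix (Fin n) (Fin n) ℝ} {g : Euc n → Euc n}

/-- Limits of solutions of approximate problems with vanishing tolerance are Filippov solutions. -/
theorem ultraLim_isFilippovSol {ι : Type*} {U : Ultrafilter ι} (hq0 : 0 < q) (hq1 : q ≤ 1)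
    (hg : Continuous g) {T M : ℝ} {v x : ι → ℝ → Euc n}
    (hV : ∀ᶠ k in (U : Filter ι), IsVolterra q x₀ T M (v k) (x k)) {τ : ℝ} (hτ : τ ∈ Icc 0 T)
    {ε : ι → ℝ} (hε : ∀ η > 0, ∀ᶠ k in (U : Filter ι), ε k ≤ η) {h : ι → Euc n → Euc n}
    (hh : ∀ k, IsApproxSelection (SwitchTerm A) (ε k) (h k))
    (hv : ∀ r < τ, ∀ᶠ k in (U : Filter ι), ∀ s ∈ Icc 0 r, v k s = g (x k s) + h k (x k s)) :
    IsInclusionSol q (filippov fun y => g y + switchTerm A y) x₀ τ (ultraLim U x) := by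
  refine ultraLim_isInclusionSol hq0 hq1 hV hτ
    (fun y => by rw [filippov_eq A hg]; exact convex_translate A _ _)
    (fun y => by rw [filippov_eq A hg]; exact (isCompact_translate A _ _).isClosed) ?_
  intro t ht ρ hρ
  rw [filippov_eq A hg]
  obtain ⟨η, hη, happ⟩ := approxSelection_mem_cthickening A hg (ultraLim U x t) hρ
  obtain ⟨θ, hθ, hm⟩ := exists_holder_modulus hq0 (2 * M / Real.Gamma (q + 1))
    (ρ := η / 2) (by positivity)
  have htT : t ∈ Icc 0 T := ⟨ht.1.le, ht.2.le.trans hτ.2⟩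
  -- The second bound keeps s below (t + τ)/2 < τ, where `v k` is known to be the approximate
  -- right-hand side.
  refine ⟨min θ ((τ - t) / 2), lt_min hθ (by linarith [ht.2]), ?_⟩
  filter_upwards [hε η hη, hv ((t + τ) / 2) (by linarith [ht.2]),
    ultraLim_uniform hq0 hq1 hV (half_pos hη)] with k hk1 hk2 hk3 s hs hst
  have hst' := lt_min_iff.1 hst
  rw [hk2 s ⟨hs.1, by linarith [(abs_lt.1 hst'.2).2]⟩]
  refine happ (ε k) hk1 (h k) (hh k) _ ?_
  have := (ultraLim_holder hq0 hq1 hV htT hs).trans (hm _ hst'.1)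
  exact (norm_sub_le_norm_sub_add_norm_sub _ (ultraLim U x s) _).trans
    (by linarith [hk3 s hs])

theorem exists_atTop_ultrafilter : ∃ U : Ultrafilter ℕ, (U : Filter ℕ) ≤ atTop :=
  ⟨_, Ultrafilter.of_le atTop⟩

theorem eventually_le_of_lt_inv {ε : ℕ → ℝ} (h : ∀ k, ε k < 1 / ((k : ℝ) + 1)) {η : ℝ}
    (hη : 0 < η) : ∀ᶠ k in atTop, ε k ≤ η := by
  filter_upwards [tendsto_one_div_add_atTop_nhds_zero_nat.eventually_lt_const hη] with k hk
  exact (h k).le.trans hk.le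

/-- Absence of blow-up is stable under passing to approximate problems. -/
theorem exists_uniform_bound (hq0 : 0 < q) (hq1 : q ≤ 1) (hg : Continuous g) {T : ℝ}
    (hb : NoBlowUp (IsInclusionSol q (filippov fun y => g y + switchTerm A y) x₀) T) :
    ∃ R, ∃ ε₀ > 0, ∀ ε ∈ Ioo 0 ε₀, ∀ h : Euc n → Euc n, Continuous h →
      IsApproxSelection (SwitchTerm A) ε h → ∀ T' ∈ Ioc 0 T, ∀ x,
        IsCaputoSol q (fun y => g y + h y) x₀ T' x → ∀ t ∈ Icc 0 T', ‖x t‖ ≤ R := by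
  obtain ⟨R₀, hR₀⟩ := hb
  set R := max R₀ ‖x₀‖ with hR
  refine ⟨R + 1, ?_⟩
  by_contra! hcon
  choose ε hε h hhc hh T' hT' x hx t ht hxt using fun k : ℕ =>
    hcon (1 / ((k : ℝ) + 1)) (by positivity)
  have hx0 : ∀ k, ‖x k 0‖ < R + 1 := fun k => by
    rw [(hx k).init]
    linarith [le_max_right R₀ ‖x₀‖]
  choose τ hτ hτ1 hle using fun k =>
    exists_first_exit (hx k).cont.norm (hx0 k) (ht k) (hxt k).le
  have hτT : ∀ k, τ k ∈ Icc 0 T := fun k => ⟨(hτ k).1.le, (hτ k).2.trans (hT' k).2⟩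
  obtain ⟨G, hG0, hG⟩ := hg.exists_bound_closedBall 0 (R + 1)
  obtain ⟨L, hL0, hL⟩ := exists_SwitchTerm_bound A
  choose w hW hw using fun k => ((hx k).mono (hτ k).2).exists_isVolterra hq0 hq1
    (hg.add (hhc k)) (hτ k).1 (M := G + L) fun s hs => (norm_add_le _ _).trans
      (add_le_add (hG _ (by rw [sub_zero]; exact hle k s hs)) (hL 0 _ ((hh k).mem_zero _)))
  -- Right-hand sides are set to zero after the exit times, so that all `y k` live on [0, T] with
  -- one bound and agree with `x k` before exit.
  set v : ℕ → ℝ → Euc n := fun k => (Icc 0 (τ k)).indicator (w k) with hv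
  set y : ℕ → ℝ → Euc n := fun k t => x₀ + rlIntegral q (v k) t with hy
  have hV : ∀ k, IsVolterra q x₀ T (G + L) (v k) (y k) := fun k =>
    ⟨(hW k).meas.indicator measurableSet_Icc,
      fun s => (norm_indicator_le_norm_self _ _).trans ((hW k).bound s), fun _ _ => rfl⟩
  have hyx : ∀ k, ∀ s ∈ Icc 0 (τ k), y k s = x k s := fun k s hs => by
    rw [(hW k).eqn s hs]
    simp only [hy]
    rw [rlIntegral_congr hs.1 fun r hr => indicator_of_mem
      (show r ∈ Icc 0 (τ k) from ⟨hr.1, hr.2.trans hs.2⟩) (w k)]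
  obtain ⟨U, hU⟩ := exists_atTop_ultrafilter
  obtain ⟨σ, hσ, hτσ⟩ := (isCompact_Icc (a := (0 : ℝ)) (b := T)).ultrafilter_le_nhds (U.map τ)
    (le_principal_iff.2 (Eventually.of_forall hτT : ∀ᶠ k in (U : Filter ℕ), τ k ∈ Icc 0 T))
  have hτσ' : Tendsto τ U (𝓝 σ) := hτσ
  have hVe : ∀ᶠ k in (U : Filter ℕ), IsVolterra q x₀ T (G + L) (v k) (y k) :=
    Eventually.of_forall hV
  have hsol : IsInclusionSol q (filippov fun y => g y + switchTerm A y) x₀ σ (ultraLim U y) := by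
    refine ultraLim_isFilippovSol hq0 hq1 hg hVe hσ (ε := ε)
      (fun η hη => hU (eventually_le_of_lt_inv (fun k => (hε k).2) hη)) hh fun r hr => ?_
    filter_upwards [hτσ'.eventually_const_lt hr] with k hk s hs
    have hsτ : s ∈ Icc 0 (τ k) := ⟨hs.1, hs.2.trans hk.le⟩
    rw [hyx k s hsτ]
    exact (indicator_of_mem hsτ _).trans (hw k s hsτ)
  -- Uniform convergence and continuity of the limit allow evaluation at the moving times `τ k`. The
  -- limiting Filippov solution thus has norm R + 1 at σ, contradicting its bound R₀ ≤ R.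
  have hlim : Tendsto (fun k => ‖y k (τ k)‖) U (𝓝 ‖ultraLim U y σ‖) := by
    have h1 : Tendsto (fun k => ultraLim U y (τ k)) U (𝓝 (ultraLim U y σ)) :=
      ((ultraLim_continuousOn hq0 hq1 hVe) σ hσ).tendsto.comp
        (tendsto_nhdsWithin_iff.2 ⟨hτσ', Eventually.of_forall hτT⟩)
    have h2 : Tendsto (fun k => y k (τ k) - ultraLim U y (τ k)) U (𝓝 0) := by
      rw [tendsto_zero_iff_norm_tendsto_zero, Metric.tendsto_nhds]
      intro ρ hρ
      filter_upwards [ultraLim_uniform hq0 hq1 hVe (half_pos hρ)] with k hk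
      rw [dist_zero_right, norm_norm]
      exact (hk _ (hτT k)).trans_lt (half_lt_self hρ)
    simpa using (h2.add h1).norm
  have hnorm : ‖ultraLim U y σ‖ = R + 1 := by
    refine tendsto_nhds_unique hlim (tendsto_const_nhds.congr fun k => ?_)
    rw [hyx k _ ⟨(hτ k).1.le, le_rfl⟩, hτ1 k]
  have hσ0 : 0 < σ := by
    refine lt_of_le_of_ne hσ.1 fun h0 => ?_
    rw [← h0, ultraLim_zero hq0 hq1 hVe (hσ.1.trans hσ.2)] at hnorm
    linarith [le_max_right R₀ ‖x₀‖]
  have := hR₀ σ ⟨hσ0, hσ.2⟩ _ hsol σ ⟨hσ0.le, le_rfl⟩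
  linarith [le_max_left R₀ ‖x₀‖]

/-- Bounded solutions of approximate problems are close to Filippov solutions. -/
theorem exists_close_filippovSol (hq0 : 0 < q) (hq1 : q ≤ 1) (hg : Continuous g) {T : ℝ}
    (hT : 0 < T) (A : Matrix (Fin n) (Fin n) ℝ) (x₀ : Euc n) (R : ℝ) {δ : ℝ} (hδ : 0 < δ) :
    ∃ ε₀ > 0, ∀ ε ∈ Ioo 0 ε₀, ∀ h : Euc n → Euc n, Continuous h →
      IsApproxSelection (SwitchTerm A) ε h → ∀ x, IsCaputoSol q (fun y => g y + h y) x₀ T x →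
        (∀ t ∈ Icc 0 T, ‖x t‖ ≤ R) →
        ∃ z, IsInclusionSol q (filippov fun y => g y + switchTerm A y) x₀ T z ∧
          ∀ t ∈ Icc 0 T, ‖x t - z t‖ ≤ δ := by
  by_contra! hcon
  choose ε hε h hhc hh x hx hxR hbad using fun k : ℕ =>
    hcon (1 / ((k : ℝ) + 1)) (by positivity)
  obtain ⟨G, hG0, hG⟩ := hg.exists_bound_closedBall 0 R
  obtain ⟨L, hL0, hL⟩ := exists_SwitchTerm_bound A
  choose v hV hv using fun k => (hx k).exists_isVolterra hq0 hq1
    (hg.add (hhc k)) hT (M := G + L) fun s hs => (norm_add_le _ _).trans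
      (add_le_add (hG _ (by rw [sub_zero]; exact hxR k s hs)) (hL 0 _ ((hh k).mem_zero _)))
  obtain ⟨U, hU⟩ := exists_atTop_ultrafilter
  have hVe : ∀ᶠ k in (U : Filter ℕ), IsVolterra q x₀ T (G + L) (v k) (x k) :=
    Eventually.of_forall hV
  have hsol : IsInclusionSol q (filippov fun y => g y + switchTerm A y) x₀ T (ultraLim U x) :=
    ultraLim_isFilippovSol hq0 hq1 hg hVe ⟨hT.le, le_rfl⟩ (ε := ε)
      (fun η hη => hU (eventually_le_of_lt_inv (fun k => (hε k).2) hη)) hh fun r hr =>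
      Eventually.of_forall fun k s hs => hv k s ⟨hs.1, hs.2.trans hr.le⟩
  obtain ⟨k, hk⟩ := (ultraLim_uniform hq0 hq1 hVe hδ).exists
  obtain ⟨t, ht, hlt⟩ := hbad k _ hsol
  exact hlt.not_ge (hk t ht)

theorem noBlowUp_of_isDominated (hq0 : 0 < q) (hq1 : q ≤ 1) (hg : Continuous g) {L : ℝ}
    (hL0 : 0 ≤ L) (hL : ∀ x, ∀ z ∈ SwitchTerm A x, ‖z‖ ≤ L) {T : ℝ}
    (hb : NoBlowUp (IsDominated q g L x₀) T) :
    NoBlowUp (IsInclusionSol q (filippov fun y => g y + switchTerm A y) x₀) T ∧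
      ∀ ε > 0, ∀ h : Euc n → Euc n, Continuous h → IsApproxSelection (SwitchTerm A) ε h →
        NoBlowUp (IsCaputoSol q (fun y => g y + h y) x₀) T := by
  refine ⟨hb.imp fun T' hT' x hx => hx.isDominated hq0 hq1 hg hL0 ?_ hT',
    fun ε _ h hhc hh => hb.imp fun T' hT' x hx =>
      hx.isDominated hq0 hq1 hg hhc (fun y => hL 0 _ (hh.mem_zero y)) hT'⟩
  intro y z hz
  rw [filippov_eq A hg] at hz
  obtain ⟨w, hw, rfl⟩ := hz
  exact (norm_add_le _ _).trans (add_le_add_right (hL y w hw) _)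

/-- Existence comes from the scheme itself, which for large N is close to a solution. -/
theorem exists_isCaputoSol (hq0 : 0 < q) (hq1 : q ≤ 1) {f : Euc n → Euc n} (hf : Continuous f)
    {T : ℝ} (hT : 0 < T) (hb : NoBlowUp (IsCaputoSol q f x₀) T) : ∃ x, IsCaputoSol q f x₀ T x := by
  obtain ⟨N, x, hx, -⟩ := (dff_converges hq0 hq1 hf hT hb one_pos).exists
  exact ⟨x, hx⟩

end

/-! ### Proof of the theorem -/

theorem theorem2 {n : ℕ} (q : ℝ) (hq0 : 0 < q) (hq1 : q ≤ 1)
    (g : Euc n → Euc n) (hg : Continuous g) (A : Matrix (Fin n) (Fin n) ℝ) (x₀ : Euc n) :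
    -- the Filippov regularization of the right-hand side is `g + A S`
    (∀ x, filippov (fun y => g y + switchTerm A y) x
        = (fun z => g x + z) '' SwitchTerm A x) ∧
    -- there are locally Lipschitz approximate selections which differ from `A s` only near
    -- the switching points
    (∀ ε > 0, ∃ h : Euc n → Euc n, LocallyLipschitz h ∧ IsApproxSelection (SwitchTerm A) ε h ∧
        ∀ x ∉ Metric.thickening ε (switchSet fun y => g y + switchTerm A y),
          h x = switchTerm A x) ∧
    -- no blow-up on a short interval, uniformly in the approximation
    (∃ T > 0,
        NoBlowUp (IsInclusionSol q (filippov fun y => g y + switchTerm A y) x₀) T ∧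
        ∀ ε > 0, ∀ h : Euc n → Euc n, Continuous h → IsApproxSelection (SwitchTerm A) ε h →
          NoBlowUp (IsCaputoSol q (fun y => g y + h y) x₀) T) ∧
    -- no blow-up at all if `g` has linear growth
    ((∃ C : ℝ, ∀ x, ‖g x‖ ≤ C * (1 + ‖x‖)) → ∀ T > 0,
        NoBlowUp (IsInclusionSol q (filippov fun y => g y + switchTerm A y) x₀) T ∧
        ∀ ε > 0, ∀ h : Euc n → Euc n, Continuous h → IsApproxSelection (SwitchTerm A) ε h →
          NoBlowUp (IsCaputoSol q (fun y => g y + h y) x₀) T) ∧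
    -- the continuous approximate problem, for every continuous approximate selection
    (∀ ε > 0, ∀ h : Euc n → Euc n, Continuous h → IsApproxSelection (SwitchTerm A) ε h →
        -- solvability on `[0, T]` and convergence of the scheme to the set of solutions
        (∀ T > 0, NoBlowUp (IsCaputoSol q (fun y => g y + h y) x₀) T →
          (∃ x, IsCaputoSol q (fun y => g y + h y) x₀ T x) ∧
          ∀ δ > 0, ∀ᶠ N : ℕ in atTop, ∃ x, IsCaputoSol q (fun y => g y + h y) x₀ T x ∧
            DffWithin q (fun y => g y + h y) x₀ T N δ x) ∧
        -- solvability on `[0, ∞)`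
        ((∀ T > 0, NoBlowUp (IsCaputoSol q (fun y => g y + h y) x₀) T) →
          ∃ x, ∀ T > 0, IsCaputoSol q (fun y => g y + h y) x₀ T x) ∧
        -- convergence to the solution whenever it is unique
        (∀ T > 0, ∀ x, IsCaputoSol q (fun y => g y + h y) x₀ T x →
          (∀ T' ∈ Ioc 0 T, ∀ y, IsCaputoSol q (fun y => g y + h y) x₀ T' y →
            EqOn y x (Icc 0 T')) →
          ∀ δ > 0, ∀ᶠ N : ℕ in atTop, DffWithin q (fun y => g y + h y) x₀ T N δ x) ∧
        -- uniqueness in the locally Lipschitz case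
        (LocallyLipschitz g → LocallyLipschitz h → ∀ T > 0, ∀ x y,
          IsCaputoSol q (fun y => g y + h y) x₀ T x →
          IsCaputoSol q (fun y => g y + h y) x₀ T y → EqOn y x (Icc 0 T))) ∧
    -- the original problem, solved in the sense of Filippov
    (∀ T > 0, NoBlowUp (IsInclusionSol q (filippov fun y => g y + switchTerm A y) x₀) T →
        (∃ x, IsInclusionSol q (filippov fun y => g y + switchTerm A y) x₀ T x) ∧
        ∀ δ > 0, ∃ ε₀ > 0, ∀ ε ∈ Ioo 0 ε₀, ∀ h : Euc n → Euc n, Continuous h →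
          IsApproxSelection (SwitchTerm A) ε h →
          -- solutions of the approximate problem are close to Filippov solutions
          NoBlowUp (IsCaputoSol q (fun y => g y + h y) x₀) T ∧
          (∀ x, IsCaputoSol q (fun y => g y + h y) x₀ T x →
            ∃ z, IsInclusionSol q (filippov fun y => g y + switchTerm A y) x₀ T z ∧
              ∀ t ∈ Icc 0 T, ‖x t - z t‖ ≤ δ) ∧
          -- and so are the values which the scheme computes
          ∀ᶠ N : ℕ in atTop,
            ∃ z, IsInclusionSol q (filippov fun y => g y + switchTerm A y) x₀ T z ∧
              DffWithin q (fun y => g y + h y) x₀ T N δ z) := by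
  refine ⟨filippov_eq A hg, fun ε hε => exists_lipschitz_selection A hg hε, ?_, ?_, ?_, ?_⟩
  · obtain ⟨L, hL0, hL⟩ := exists_SwitchTerm_bound A
    obtain ⟨T, hT, hb⟩ := exists_noBlowUp_isDominated hq0 hq1 hg L x₀
    exact ⟨T, hT, noBlowUp_of_isDominated hq0 hq1 hg hL0 hL hb⟩
  · rintro ⟨C, hC⟩ T -
    obtain ⟨L, hL0, hL⟩ := exists_SwitchTerm_bound A
    exact noBlowUp_of_isDominated hq0 hq1 hg hL0 hL
      (noBlowUp_isDominated_of_linear hq0 hq1 hL0 x₀ hC T)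
  · intro ε _ h hhc _
    have hf : Continuous fun y => g y + h y := hg.add hhc
    refine ⟨fun T hT hb => ⟨exists_isCaputoSol hq0 hq1 hf hT hb,
      fun δ hδ => dff_converges hq0 hq1 hf hT hb hδ⟩,
      fun hb => exists_global_isCaputoSol hq0 hq1 hf hb, fun T hT x hx huniq δ hδ => ?_,
      fun hgl hhl T hT x y hx hy => hx.unique hq0 hq1 (hgl.add hhl) hT hy⟩
    -- Uniqueness on all subintervals excludes blow-up: the bound of x bounds every other solution.
    have hb : NoBlowUp (IsCaputoSol q (fun y => g y + h y) x₀) T := by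
      obtain ⟨R, -, hR⟩ := exists_norm_bound hx.cont
      refine ⟨R, fun T' hT' y hy t ht => ?_⟩
      rw [huniq T' hT' y hy ht]
      exact hR t ⟨ht.1, ht.2.trans hT'.2⟩
    filter_upwards [dff_converges hq0 hq1 hf hT hb hδ, eventually_gt_atTop 0] with N ⟨y, hy, hyN⟩ hN
    intro k hk
    rw [← huniq T ⟨hT, le_rfl⟩ y hy (grid_mem hT.le hN hk)]
    exact hyN k hk
  · intro T hT hb
    obtain ⟨R, ε₁, hε₁, hR⟩ := exists_uniform_bound hq0 hq1 hg hb
    have hclose : ∀ δ > 0, ∃ ε₀ > 0, ∀ ε ∈ Ioo 0 ε₀, ∀ h : Euc n → Euc n, Continuous h →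
        IsApproxSelection (SwitchTerm A) ε h →
        NoBlowUp (IsCaputoSol q (fun y => g y + h y) x₀) T ∧
        ∀ x, IsCaputoSol q (fun y => g y + h y) x₀ T x →
          ∃ z, IsInclusionSol q (filippov fun y => g y + switchTerm A y) x₀ T z ∧
            ∀ t ∈ Icc 0 T, ‖x t - z t‖ ≤ δ := by
      intro δ hδ
      obtain ⟨ε₂, hε₂, hc⟩ := exists_close_filippovSol hq0 hq1 hg hT A x₀ R hδ
      refine ⟨min ε₁ ε₂, lt_min hε₁ hε₂, fun ε hε h hhc hh => ?_⟩
      have hb' := hR ε ⟨hε.1, hε.2.trans_le (min_le_left _ _)⟩ h hhc hh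
      exact ⟨⟨R, hb'⟩, fun x hx => hc ε ⟨hε.1, hε.2.trans_le (min_le_right _ _)⟩ h hhc hh x hx
        (hb' T ⟨hT, le_rfl⟩ x hx)⟩
    refine ⟨?_, fun δ hδ => ?_⟩
    -- A Filippov solution is found near a solution of one approximate problem; any accuracy would
    -- do, and the value 1 is arbitrary.
    · obtain ⟨ε₀, hε₀, hc⟩ := hclose 1 one_pos
      obtain ⟨h, hhl, hh, -⟩ := exists_lipschitz_selection A hg (half_pos hε₀)
      obtain ⟨hb', hex⟩ := hc (ε₀ / 2) ⟨half_pos hε₀, half_lt_self hε₀⟩ h hhl.continuous hh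
      obtain ⟨x, hx⟩ := exists_isCaputoSol hq0 hq1 (hg.add hhl.continuous) hT hb'
      obtain ⟨z, hz, -⟩ := hex x hx
      exact ⟨z, hz⟩
    -- Half of δ is spent on passing from (2) to a Filippov solution, the other half on the
    -- discretization.
    · obtain ⟨ε₀, hε₀, hc⟩ := hclose (δ / 2) (half_pos hδ)
      refine ⟨ε₀, hε₀, fun ε hε h hhc hh => ?_⟩
      obtain ⟨hb', hex⟩ := hc ε hε h hhc hh
      have hf : Continuous fun y => g y + h y := hg.add hhc
      refine ⟨hb', fun x hx => ?_, ?_⟩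
      · obtain ⟨z, hz, hxz⟩ := hex x hx
        exact ⟨z, hz, fun t ht => (hxz t ht).trans (half_le_self hδ.le)⟩
      · filter_upwards [dff_converges hq0 hq1 hf hT hb' (half_pos hδ),
          eventually_gt_atTop 0] with N ⟨x, hx, hxN⟩ hN
        obtain ⟨z, hz, hxz⟩ := hex x hx
        refine ⟨z, hz, fun k hk => ?_⟩
        refine (norm_sub_le_norm_sub_add_norm_sub _ (x (k * (T / N))) _).trans ?_
        have h1 := hxN k hk
        have h2 := hxz _ (grid_mem hT.le hN hk)
        linarith
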